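/- Let $G$ be an amenable group, and let $\mu$ be a $G$-invariant finitely additive probability measure on $G$, i.e. $\mu$ is defined on all subsets of $G$ and $\mu(gA)=\mu(A)=\mu(Ag)$ for all $A\subseteq G$ and $g\in G$. Let $r\in\mathbb{N}$ and let $c:G\to\{1,\dots,r\}$ be any coloring. Then $$\mu\big(\{y:\ \mu(\{x:\ \{x,y,xy,yx\}\text{ is monochromatic}\})>0\}\big)>0.$$ More generally, for every $k\ge 0$ and $x_0,\dots,x_k\in G$ put $$S(x_0,\dots,x_k)=\Big\{x_i x_{i+1}\cdots x_j:\ 0\le i\le j\le k\Big\}\cup\Big\{\Big(\overrightarrow{\prod_{a\in I}}x_a\Big)\, x_0x_1\cdots x_j:\ 0\le j\le k,\ I\subseteq\{j+1,\dots,k\}\Big\},$$ where $\overrightarrow{\prod}_{a\in I}x_a$ is the product of the $x_a$, $a\in I$, written from left to right in increasing order of the index (it equals $1$ if $I=\emptyset$). Then there are many tuples $(x_k,x_{k-1},\dots,x_0)$ for which $S(x_0,\dots,x_k)$ is monochromatic, in the sense that $$\mu\Big(\Big\{x_k:\ \mu\big(\big\{x_{k-1}:\ \cdots\ \mu(\{x_0:\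 S(x_0,\dots,x_k)\text{ is monochromatic}\})>0\ \cdots\big\}\big)>0\Big\}\Big)>0.$$ -/

import Mathlib

open scoped NNReal Pointwise

/-- `μ` is a `G`-invariant finitely additive probability measure defined on all subsets of `G`:
a finitely additive set function on the family of all subsets, with total mass `1` and
`μ (g A) = μ A = μ (A g)`. -/
structure IsInvariantProb {G : Type*} [Group G]
    (μ : MeasureTheory.AddContent ℝ≥0 (Set.univ : Set (Set G))) : Prop where
  univ_eq_one : μ Set.univ = 1
  left_inv : ∀ (g : G) (A : Set G), μ (g • A) = μ A
  right_inv : ∀ (g : G) (A : Set G), μ (MulOpposite.op g • A) = μ A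

/-- There are many tuples `(t 0, …, t (n - 1))` satisfying `P`:
`μ {t 0 | μ {t 1 | … μ {t (n - 1) | P t} > 0 …} > 0} > 0`. -/
def Many {G : Type*} (μ : MeasureTheory.AddContent ℝ≥0 (Set.univ : Set (Set G))) :
    (n : ℕ) → ((Fin n → G) → Prop) → Prop
  | 0, P => P Fin.elim0
  | n + 1, P => 0 < μ {y | Many μ n fun t => P (Fin.cons y t)}

/-- `S` is monochromatic for the coloring `c`. -/
def IsMonochromatic {G κ : Type*} (c : G → κ) (S : Set G) : Prop :=
  ∃ a : κ, ∀ g ∈ S, c g = a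

/-- The product of the `x a`, `a ∈ I`, written from left to right with increasing index. -/
def orderedProd {G : Type*} [Group G] {n : ℕ} (x : Fin n → G) (I : Finset (Fin n)) : G :=
  (I.sort.map x).prod

/-- The set of all `x i ⋯ x j` with `i ≤ j ≤ k`, and of all `(∏_{a ∈ I} x a) · x 0 ⋯ x j` with
`j ≤ k` and `I ⊆ {j + 1, …, k}`. -/
def productPattern {G : Type*} [Group G] {k : ℕ} (x : Fin (k + 1) → G) : Set G :=
  {g | ∃ i j : Fin (k + 1), i ≤ j ∧ g = orderedProd x (Finset.Icc i j)} ∪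
  {g | ∃ (j : Fin (k + 1)) (I : Finset (Fin (k + 1))), I ⊆ Finset.Ioi j ∧
    g = orderedProd x I * orderedProd x (Finset.Iic j)}

/-!
Colour focusing reduces the theorem to amenable corners: if `f` has positive mean on a space with a
mean-preserving action `z ↦ p z q`, then for a set of `g` of positive mean the points `z`, `g z` and
`z g` lie in the set given by `f` for many `z`. Applied to a product of systems this holds for
several sets with the same `g`; colouring `g` then makes one of the colour classes longer by one
entry.

Corners are triangles. In a tripartite graph with one copy of `G` for each class, the triangle with
labels `a, b, c` is a corner of size `b * c * a⁻¹`, and at size `1` its three edges coincide.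
Finitely additive means satisfy no Fubini theorem, so the vertices are sampled in a linear order and
integrated in that order. This gives a random Boolean array whose law does not depend on the choice
of increasing times and which lives on an honest probability space. There, conditioning on more
edges gains nothing once an identically distributed copy of those edges has been seen, which gives
the conditional independence of the edges of a triangle. If almost no triangles existed, counting
the cells cut out by finitely many sampled vertices, and evaluating at the roots, where the three
edges coincide, would bound the square of the edge density by a quantity that tends to `0` by
martingale convergence.
-/

open Filter Topology Function

/-- Bounded real functions: the functions on which a finitely additive mean is defined. -/
def BddFun {X : Type*} (f : X → ℝ) : Prop := ∃ C : ℝ, ∀ x, |f x| ≤ C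

namespace BddFun

variable {X Y : Type*} {f g : X → ℝ}

lemma const (c : ℝ) : BddFun fun _ : X => c := ⟨|c|, fun _ => le_rfl⟩

lemma add (hf : BddFun f) (hg : BddFun g) : BddFun fun x => f x + g x := by
  obtain ⟨C, hC⟩ := hf
  obtain ⟨D, hD⟩ := hg
  exact ⟨C + D, fun x => (abs_add_le _ _).trans (add_le_add (hC x) (hD x))⟩

lemma mul (hf : BddFun f) (hg : BddFun g) : BddFun fun x => f x * g x := by
  obtain ⟨C, hC⟩ := hf
  obtain ⟨D, hD⟩ := hg
  refine ⟨C * D, fun x => ?_⟩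
  rw [abs_mul]
  exact mul_le_mul (hC x) (hD x) (abs_nonneg _) ((abs_nonneg _).trans (hC x))

lemma const_mul (c : ℝ) (hf : BddFun f) : BddFun fun x => c * f x := (const c).mul hf

lemma sum {ι : Type*} (s : Finset ι) {f : ι → X → ℝ} (hf : ∀ i ∈ s, BddFun (f i)) :
    BddFun fun x => ∑ i ∈ s, f i x := by
  classical
  induction s using Finset.induction_on with
  | empty => simpa using const 0
  | insert a s ha ih =>
    simp only [Finset.sum_insert ha]
    exact (hf a (by simp)).add (ih fun i hi => hf i (by simp [hi]))

lemma comp (hf : BddFun f) (g : Y → X) : BddFun fun y => f (g y) := by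
  obtain ⟨C, hC⟩ := hf
  exact ⟨C, fun y => hC (g y)⟩

lemma of_mem_Icc (h0 : ∀ x, 0 ≤ f x) (h1 : ∀ x, f x ≤ 1) : BddFun f :=
  ⟨1, fun x => abs_le.2 ⟨by linarith [h0 x], h1 x⟩⟩

end BddFun

open Classical in
/-- The indicator of a proposition as a real number, so that probabilities of events are means or
integrals of `fun x => ind (p x)`. -/
noncomputable def ind (p : Prop) : ℝ := if p then 1 else 0

@[simp] lemma ind_of {p : Prop} (h : p) : ind p = 1 := if_pos h
@[simp] lemma ind_of_not {p : Prop} (h : ¬ p) : ind p = 0 := if_neg h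
lemma ind_nonneg (p : Prop) : 0 ≤ ind p := by by_cases h : p <;> simp [h]
lemma ind_le_one (p : Prop) : ind p ≤ 1 := by by_cases h : p <;> simp [h]
lemma ind_and (p q : Prop) : ind (p ∧ q) = ind p * ind q := by
  by_cases h : p <;> by_cases h' : q <;> simp [h, h']
lemma ind_congr {p q : Prop} (h : p ↔ q) : ind p = ind q := by rw [propext h]
lemma BddFun.ind {X : Type*} (p : X → Prop) : BddFun fun x => ind (p x) :=
  .of_mem_Icc (fun _ => ind_nonneg _) (fun _ => ind_le_one _)

/-- A mean, that is a finitely additive integral of total mass `1`. It is defined on all real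
functions, but its laws are only required on bounded ones. -/
structure Mean (X : Type*) where
  toFun : (X → ℝ) → ℝ
  const' : ∀ c, toFun (fun _ => c) = c
  add' : ∀ {f g}, BddFun f → BddFun g → toFun (fun x => f x + g x) = toFun f + toFun g
  const_mul' : ∀ (c : ℝ) {f}, BddFun f → toFun (fun x => c * f x) = c * toFun f
  mono' : ∀ {f g}, BddFun f → BddFun g → (∀ x, f x ≤ g x) → toFun f ≤ toFun g

namespace Mean

variable {X Y : Type*}

instance : CoeFun (Mean X) fun _ => (X → ℝ) → ℝ := ⟨toFun⟩

lemma const (m : Mean X) (c : ℝ) : m (fun _ => c) = c := m.const' c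

lemma add (m : Mean X) {f g : X → ℝ} (hf : BddFun f) (hg : BddFun g) :
    m (fun x => f x + g x) = m f + m g := m.add' hf hg

lemma const_mul (m : Mean X) (c : ℝ) {f : X → ℝ} (hf : BddFun f) :
    m (fun x => c * f x) = c * m f := m.const_mul' c hf

lemma mono (m : Mean X) {f g : X → ℝ} (hf : BddFun f) (hg : BddFun g) (h : ∀ x, f x ≤ g x) :
    m f ≤ m g := m.mono' hf hg h

lemma sub (m : Mean X) {f g : X → ℝ} (hf : BddFun f) (hg : BddFun g) :
    m (fun x => f x - g x) = m f - m g := by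
  have h := m.add hf (hg.const_mul (-1))
  rw [m.const_mul _ hg] at h
  simpa only [neg_one_mul, ← sub_eq_add_neg] using h

lemma sum (m : Mean X) {ι : Type*} (s : Finset ι) {f : ι → X → ℝ}
    (hf : ∀ i ∈ s, BddFun (f i)) : m (fun x => ∑ i ∈ s, f i x) = ∑ i ∈ s, m (f i) := by
  classical
  induction s using Finset.induction_on with
  | empty => simpa using m.const 0
  | insert a s ha ih =>
    have hs : ∀ i ∈ s, BddFun (f i) := fun i hi => hf i (by simp [hi])
    simp only [Finset.sum_insert ha]
    rw [m.add (hf a (by simp)) (.sum s hs), ih hs]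

lemma le_of_forall_le (m : Mean X) {f : X → ℝ} {c : ℝ} (hf : BddFun f) (h : ∀ x, f x ≤ c) :
    m f ≤ c := (m.mono hf (.const c) h).trans_eq (m.const c)

lemma le_of_forall_ge (m : Mean X) {f : X → ℝ} {c : ℝ} (hf : BddFun f) (h : ∀ x, c ≤ f x) :
    c ≤ m f := (m.const c).symm.trans_le (m.mono (.const c) hf h)

lemma abs_le (m : Mean X) {f : X → ℝ} {c : ℝ} (h : ∀ x, |f x| ≤ c) : |m f| ≤ c :=
  _root_.abs_le.2 ⟨m.le_of_forall_ge ⟨c, h⟩ fun x => (_root_.abs_le.1 (h x)).1,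
    m.le_of_forall_le ⟨c, h⟩ fun x => (_root_.abs_le.1 (h x)).2⟩

lemma abs_sub_le (m : Mean X) {f g : X → ℝ} {c : ℝ} (hf : BddFun f) (hg : BddFun g)
    (h : ∀ x, |f x - g x| ≤ c) : |m f - m g| ≤ c := by
  rw [← m.sub hf hg]
  exact m.abs_le h

lemma bddFun {m : Y → Mean X} {F : Y → X → ℝ} (h : ∃ C, ∀ y x, |F y x| ≤ C) :
    BddFun fun y => m y (F y) := by
  obtain ⟨C, hC⟩ := h
  exact ⟨C, fun y => (m y).abs_le (hC y)⟩

lemma bddFun_apply {m : Y → Mean X} {f : X → ℝ} (hf : BddFun f) : BddFun fun y => m y f :=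
  bddFun (hf.imp fun _ hC _ => hC)

/-- The iterated mean `F ↦ m (x ↦ n x F)`. The order matters: means do not satisfy Fubini. -/
def bind (m : Mean X) (n : X → Mean Y) : Mean Y where
  toFun F := m fun x => n x F
  const' c := by simp [const]
  add' hf hg := by simp only [fun x => (n x).add hf hg, m.add (bddFun_apply hf) (bddFun_apply hg)]
  const_mul' c f hf := by simp only [fun x => (n x).const_mul c hf, m.const_mul c (bddFun_apply hf)]
  mono' hf hg h := m.mono (bddFun_apply hf) (bddFun_apply hg) fun x => (n x).mono hf hg h

/-- The pushforward of a mean. -/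
def map (m : Mean X) (g : X → Y) : Mean Y where
  toFun F := m fun x => F (g x)
  const' c := m.const c
  add' hf hg := m.add (hf.comp g) (hg.comp g)
  const_mul' c _ hf := m.const_mul c (hf.comp g)
  mono' hf hg h := m.mono (hf.comp g) (hg.comp g) fun _ => h _

/-- The point mass at `x`, as a mean. -/
def dirac (x : X) : Mean X where
  toFun F := F x
  const' _ := rfl
  add' _ _ := rfl
  const_mul' _ _ _ := rfl
  mono' _ _ h := h x

lemma exists_tendsto {ι : Type*} (u : Ultrafilter ι) {a : ι → ℝ} {C : ℝ} (h : ∀ i, |a i| ≤ C) :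
    ∃ l, Tendsto a u (𝓝 l) := by
  have hc : IsCompact (Set.Icc (-C) C) := isCompact_Icc
  obtain ⟨l, -, hl⟩ := hc.ultrafilter_le_nhds (u.map a)
    (by
      rw [le_principal_iff]
      exact Filter.Eventually.of_forall (f := (u : Filter ι)) fun i => _root_.abs_le.1 (h i))
  exact ⟨l, hl⟩

lemma tendsto_limUnder {ι : Type*} (u : Ultrafilter ι) {a : ι → ℝ} {C : ℝ}
    (h : ∀ i, |a i| ≤ C) : Tendsto a u (𝓝 (limUnder (u : Filter ι) a)) :=
  tendsto_nhds_limUnder (exists_tendsto u h)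

/-- The limit of a family of means along an ultrafilter, which exists because the means of a bounded
function are bounded. -/
noncomputable def ulim {ι : Type*} (u : Ultrafilter ι) (m : ι → Mean X) : Mean X where
  toFun F := limUnder (u : Filter ι) fun i => m i F
  const' c := by
    simp only [const]
    exact tendsto_const_nhds.limUnder_eq
  add' := by
    rintro f g ⟨C, hC⟩ ⟨D, hD⟩
    simp only [fun i => (m i).add ⟨C, hC⟩ ⟨D, hD⟩]
    exact ((tendsto_limUnder u fun i => (m i).abs_le hC).add
      (tendsto_limUnder u fun i => (m i).abs_le hD)).limUnder_eq
  const_mul' := by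
    rintro c f ⟨C, hC⟩
    simp only [fun i => (m i).const_mul c ⟨C, hC⟩]
    exact ((tendsto_limUnder u fun i => (m i).abs_le hC).const_mul c).limUnder_eq
  mono' := by
    rintro f g ⟨C, hC⟩ ⟨D, hD⟩ h
    exact le_of_tendsto_of_tendsto' (tendsto_limUnder u fun i => (m i).abs_le hC)
      (tendsto_limUnder u fun i => (m i).abs_le hD) fun i => (m i).mono ⟨C, hC⟩ ⟨D, hD⟩ h

lemma ulim_eq {ι : Type*} {u : Ultrafilter ι} {m : ι → Mean X} {f : X → ℝ} {l : ℝ}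
    (h : ∀ᶠ i in (u : Filter ι), m i f = l) : ulim u m f = l :=
  (tendsto_const_nhds.congr' (h.mono fun _ hi => hi.symm)).limUnder_eq

lemma exists_sum_ind_approx {f : X → ℝ} (hf : BddFun f) {ε : ℝ} (hε : 0 < ε) :
    ∃ s : Finset ℤ, ∀ x, |f x - ∑ v ∈ s, ε * v * ind (⌊f x / ε⌋ = v)| ≤ ε := by
  obtain ⟨C, hC⟩ := hf
  refine ⟨Finset.Icc ⌊-C / ε⌋ ⌊C / ε⌋, fun x => ?_⟩
  obtain ⟨hl, hu⟩ := _root_.abs_le.1 (hC x)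
  have hmem : ⌊f x / ε⌋ ∈ Finset.Icc ⌊-C / ε⌋ ⌊C / ε⌋ :=
    Finset.mem_Icc.2 ⟨Int.floor_mono (by gcongr), Int.floor_mono (by gcongr)⟩
  rw [Finset.sum_eq_single_of_mem _ hmem fun v _ hv => by rw [ind_of_not hv.symm, mul_zero],
    ind_of rfl, mul_one]
  have h1 := (le_div_iff₀ hε).1 (Int.floor_le (f x / ε))
  have h2 := (div_lt_iff₀ hε).1 (Int.lt_floor_add_one (f x / ε))
  rw [_root_.abs_le]
  constructor <;> linarith

lemma sum_ind_congr {m n : Mean X}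
    (h : ∀ p : X → Prop, m (fun x => ind (p x)) = n fun x => ind (p x)) {ι : Type*}
    (s : Finset ι) (a : ι → ℝ) (p : ι → X → Prop) :
    m (fun x => ∑ v ∈ s, a v * ind (p v x)) = n fun x => ∑ v ∈ s, a v * ind (p v x) := by
  have hb : ∀ v ∈ s, BddFun fun x => a v * ind (p v x) := fun v _ => (BddFun.ind _).const_mul _
  rw [m.sum s hb, n.sum s hb]
  refine Finset.sum_congr rfl fun v _ => ?_
  rw [m.const_mul _ (BddFun.ind _), n.const_mul _ (BddFun.ind _), h]

lemma ext_ind {m n : Mean X} (h : ∀ p : X → Prop, m (fun x => ind (p x)) = n fun x => ind (p x))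
    {f : X → ℝ} (hf : BddFun f) : m f = n f := by
  refine eq_of_forall_dist_le fun ε hε => ?_
  obtain ⟨s, hs⟩ := exists_sum_ind_approx hf (half_pos hε)
  set g : X → ℝ := fun x => ∑ v ∈ s, ε / 2 * v * ind (⌊f x / (ε / 2)⌋ = v)
  have hg : BddFun g := .sum s fun v _ => (BddFun.ind _).const_mul _
  have hmn : m g = n g := sum_ind_congr h s _ _
  have hm := m.abs_sub_le hf hg hs
  have hn := n.abs_sub_le hf hg hs
  rw [hmn, abs_sub_comm] at hm
  calc dist (m f) (n f) = |(m f - n g) + (n g - n f)| := by rw [Real.dist_eq]; ring_nf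
    _ ≤ |m f - n g| + |n g - n f| := abs_add_le _ _
    _ ≤ ε / 2 + ε / 2 := add_le_add (by rwa [abs_sub_comm]) (by rwa [abs_sub_comm])
    _ = ε := add_halves ε

end Mean

section ContentIntegral

open MeasureTheory (AddContent IsSetRing addContent_empty addContent_biUnion_eq)

variable {G : Type*} (μ : AddContent ℝ≥0 (Set.univ : Set (Set G)))

lemma isSetRing_univ {G : Type*} : IsSetRing (Set.univ : Set (Set G)) where
  empty_mem := trivial
  union_mem _ _ _ _ := trivial
  sdiff_mem _ _ _ _ := trivial

lemma addContent_eq_sum_fiber {ι : Type*} (q : G → ι) (A : Set G) (s : Finset ι)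
    (h : ∀ x ∈ A, q x ∈ s) : μ A = ∑ i ∈ s, μ (A ∩ q ⁻¹' {i}) := by
  rw [← addContent_biUnion_eq isSetRing_univ (m := μ)]
  · congr 1
    ext x
    simpa using h x
  · exact fun _ _ => trivial
  · intro i _ j _ hij
    rw [Function.onFun, Set.disjoint_left]
    rintro x ⟨-, hx⟩ ⟨-, hy⟩
    exact hij (hx.symm.trans hy)

open Classical in
/-- The atom of `x` in the algebra generated by a finite family `F` of sets, encoded as the set of
the members of `F` that contain `x`. -/
noncomputable def atomOf (F : Finset (Set G)) (x : G) : Finset (Set G) := F.filter (x ∈ ·)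

lemma mem_atomOf {F : Finset (Set G)} {x : G} {A : Set G} :
    A ∈ atomOf F x ↔ A ∈ F ∧ x ∈ A := by simp [atomOf]

lemma mem_iff_of_atomOf_eq {F : Finset (Set G)} {A : Set G} (hA : A ∈ F) {x y : G}
    (h : atomOf F x = atomOf F y) : x ∈ A ↔ y ∈ A := by
  simpa only [mem_atomOf, hA, true_and] using (Finset.ext_iff.1 h) A

lemma atomOf_mem_powerset {F : Finset (Set G)} {x : G} : atomOf F x ∈ F.powerset := by
  simp [atomOf]

/-- A Riemann sum for `∫ f dμ`: the value of `f` at one point of each atom of `F`, weighted by the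
measure of that atom. -/
noncomputable def integralApprox [Nonempty G] (hμ : μ Set.univ = 1) (F : Finset (Set G)) :
    Mean G where
  toFun f := ∑ S ∈ F.powerset, (μ (atomOf F ⁻¹' {S}) : ℝ) * f (invFun (atomOf F) S)
  const' c := by
    have := addContent_eq_sum_fiber μ (atomOf F) Set.univ F.powerset fun _ _ => atomOf_mem_powerset
    rw [hμ] at this
    simp only [Set.univ_inter] at this
    rw [← Finset.sum_mul, ← NNReal.coe_sum, ← this]
    simp
  add' _ _ := by rw [← Finset.sum_add_distrib]; simp only [mul_add]
  const_mul' c f _ := by rw [Finset.mul_sum]; exact Finset.sum_congr rfl fun _ _ => by ring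
  mono' _ _ h := Finset.sum_le_sum fun S _ => mul_le_mul_of_nonneg_left (h _) (NNReal.coe_nonneg _)

lemma integralApprox_ind [Nonempty G] (hμ : μ Set.univ = 1) {F : Finset (Set G)} {A : Set G}
    (hA : A ∈ F) : integralApprox μ hμ F (fun x => ind (x ∈ A)) = μ A := by
  rw [addContent_eq_sum_fiber μ (atomOf F) A F.powerset fun _ _ => atomOf_mem_powerset,
    NNReal.coe_sum]
  refine Finset.sum_congr rfl fun S _ => ?_
  rcases (atomOf F ⁻¹' {S}).eq_empty_or_nonempty with hS | hS
  · simp [hS]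
  have hmem : ∀ y ∈ atomOf F ⁻¹' {S}, (y ∈ A ↔ invFun (atomOf F) S ∈ A) := fun y hy =>
    mem_iff_of_atomOf_eq hA (Eq.trans hy (invFun_eq hS).symm)
  by_cases hx : invFun (atomOf F) S ∈ A
  · rw [Set.inter_eq_right.2 fun y hy => (hmem y hy).2 hx]
    simp only [ind_of hx, mul_one]
  · have : A ∩ atomOf F ⁻¹' {S} = ∅ :=
      Set.eq_empty_of_forall_notMem fun y hy => hx ((hmem y hy.2).1 hy.1)
    simp only [this, ind_of_not hx, addContent_empty, NNReal.coe_zero, mul_zero]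

/-- Integration against a finitely additive probability measure, as an ultralimit of Riemann sums
over finer and finer finite partitions. -/
noncomputable def contentMean [Nonempty G] (hμ : μ Set.univ = 1) : Mean G :=
  .ulim (Ultrafilter.of atTop) (integralApprox μ hμ)

lemma contentMean_ind [Nonempty G] (hμ : μ Set.univ = 1) (p : G → Prop) :
    contentMean μ hμ (fun x => ind (p x)) = μ {x | p x} :=
  Mean.ulim_eq <| Ultrafilter.of_le atTop <| (eventually_ge_atTop {{x | p x}}).mono
    fun _ hF => integralApprox_ind μ hμ (A := {x | p x}) (Finset.singleton_subset_iff.1 hF)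

lemma contentMean_mul_left [Group G] (hμ : IsInvariantProb μ) (g : G) {f : G → ℝ}
    (hf : BddFun f) :
    contentMean μ hμ.univ_eq_one (fun x => f (g * x)) = contentMean μ hμ.univ_eq_one f := by
  refine Mean.ext_ind (m := (contentMean μ hμ.univ_eq_one).map (g * ·)) (fun p => ?_) hf
  refine (contentMean_ind μ _ fun x => p (g * x)).trans ?_
  rw [contentMean_ind, ← hμ.left_inv g⁻¹ {x | p x}]
  congr 2
  ext x
  simp [Set.mem_inv_smul_set_iff]

lemma contentMean_mul_right [Group G] (hμ : IsInvariantProb μ) (g : G) {f : G → ℝ}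
    (hf : BddFun f) :
    contentMean μ hμ.univ_eq_one (fun x => f (x * g)) = contentMean μ hμ.univ_eq_one f := by
  refine Mean.ext_ind (m := (contentMean μ hμ.univ_eq_one).map (· * g)) (fun p => ?_) hf
  refine (contentMean_ind μ _ fun x => p (x * g)).trans ?_
  rw [contentMean_ind, ← hμ.right_inv g⁻¹ {x | p x}]
  congr 2
  ext x
  simp [Set.mem_inv_smul_set_iff]

lemma measure_pos_of_contentMean_pos [Nonempty G] (hμ : μ Set.univ = 1) {f : G → ℝ}
    (h0 : ∀ x, 0 ≤ f x) (h1 : ∀ x, f x ≤ 1) (hf : 0 < contentMean μ hμ f) :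
    0 < μ {x | 0 < f x} := by
  rw [← NNReal.coe_pos, ← contentMean_ind μ hμ]
  refine hf.trans_le (Mean.mono _ (.of_mem_Icc h0 h1) (.ind _) fun x => ?_)
  by_cases hx : 0 < f x
  · simpa [hx] using h1 x
  · rw [ind_of_not hx]; exact not_lt.1 hx

end ContentIntegral

section UnitRV

open MeasureTheory

/-- The projection of the real line onto the unit interval. -/
noncomputable def unitClamp (x : ℝ) : ℝ := max 0 (min 1 x)

lemma unitClamp_eq_self {x : ℝ} (h0 : 0 ≤ x) (h1 : x ≤ 1) : unitClamp x = x := by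
  rw [unitClamp, min_eq_right h1, max_eq_right h0]

lemma unitClamp_div_mul {a b : ℝ} (h0 : 0 ≤ a) (h : a ≤ b) : unitClamp (a / b) * b = a := by
  rw [unitClamp_eq_self (div_nonneg h0 (h0.trans h)) (div_le_one_of_le₀ h (h0.trans h))]
  exact div_mul_cancel_of_imp fun hb => le_antisymm (hb ▸ h) h0

variable {Ω : Type*} {m m' m₀ : MeasurableSpace Ω} {f g : Ω → ℝ}

/-- Random variables with values in the unit interval, the bounded random variables of the whole
argument: the σ-algebra is explicit because it varies. -/
structure UnitRV (m : MeasurableSpace Ω) (f : Ω → ℝ) : Prop where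
  meas : Measurable[m] f
  nonneg : ∀ ω, 0 ≤ f ω
  le_one : ∀ ω, f ω ≤ 1

namespace UnitRV

lemma mono (h : UnitRV m f) (hm : m ≤ m') : UnitRV m' f :=
  ⟨h.meas.mono hm le_rfl, h.nonneg, h.le_one⟩

lemma mul (hf : UnitRV m f) (hg : UnitRV m g) : UnitRV m fun ω => f ω * g ω :=
  ⟨hf.meas.mul hg.meas, fun ω => mul_nonneg (hf.nonneg ω) (hg.nonneg ω),
    fun ω => mul_le_one₀ (hf.le_one ω) (hg.nonneg ω) (hg.le_one ω)⟩

lemma ind {s : Set Ω} (hs : MeasurableSet[m] s) : UnitRV m fun ω => ind (ω ∈ s) := by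
  refine ⟨?_, fun _ => ind_nonneg _, fun _ => ind_le_one _⟩
  have : (fun ω => _root_.ind (ω ∈ s)) = s.indicator 1 := by
    ext ω
    by_cases h : ω ∈ s <;> simp [h]
  rw [this]
  exact Measurable.indicator (@measurable_const _ _ _ m _) hs

lemma ind_eq {ι : Type*} [MeasurableSpace ι] [MeasurableSingletonClass ι] {τ : Ω → ι}
    (hτ : Measurable[m] τ) (i : ι) : UnitRV m fun ω => _root_.ind (τ ω = i) :=
  .ind (s := τ ⁻¹' {i}) (hτ (measurableSet_singleton i))

lemma clamp (hf : Measurable[m] f) : UnitRV m fun ω => unitClamp (f ω) :=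
  ⟨measurable_const.max (measurable_const.min hf), fun _ => le_max_left _ _,
    fun _ => max_le zero_le_one (min_le_left _ _)⟩

lemma comp {E : Type*} [mE : MeasurableSpace E] {h : E → ℝ} (hh : UnitRV mE h) {U : Ω → E}
    (hU : Measurable[m] U) : UnitRV m fun ω => h (U ω) :=
  ⟨hh.meas.comp hU, fun _ => hh.nonneg _, fun _ => hh.le_one _⟩

lemma exists_eq_comp {E : Type*} [mE : MeasurableSpace E] {U : Ω → E}
    (hf : UnitRV (mE.comap U) f) : ∃ h, UnitRV mE h ∧ f = fun ω => h (U ω) := by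
  obtain ⟨h, hh, hfh⟩ := hf.meas.exists_eq_measurable_comp
  refine ⟨fun x => unitClamp (h x), .clamp hh, funext fun ω => ?_⟩
  rw [← unitClamp_eq_self (hf.nonneg ω) (hf.le_one ω), congrFun hfh ω, comp_apply]

lemma apply_of_countable {ι : Type*} [Countable ι] [MeasurableSpace ι]
    [MeasurableSingletonClass ι] {τ : Ω → ι} (hτ : Measurable[m] τ) {F : ι → Ω → ℝ}
    (hF : ∀ i, UnitRV m (F i)) : UnitRV m fun ω => F (τ ω) ω :=
  ⟨(measurable_from_prod_countable_right (f := uncurry F) fun i => (hF i).meas).comp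
    (hτ.prodMk measurable_id), fun ω => (hF _).nonneg ω, fun ω => (hF _).le_one ω⟩

lemma integrable {P : Measure[m₀] Ω} [IsFiniteMeasure P] (hf : UnitRV m₀ f) : Integrable f P :=
  .of_bound hf.meas.aestronglyMeasurable 1
    (ae_of_all _ fun ω => by rw [Real.norm_eq_abs, abs_of_nonneg (hf.nonneg ω)]; exact hf.le_one ω)

end UnitRV

lemma sum_ind_eq_mul {ι : Type*} [Fintype ι] (i : ι) (g : ι → ℝ) :
    ∑ j, ind (i = j) * g j = g i := by
  rw [Finset.sum_eq_single_of_mem i (Finset.mem_univ _) fun j _ hj => by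
    rw [ind_of_not hj.symm, zero_mul], ind_of rfl, one_mul]

lemma integral_apply_eq_sum {ι : Type*} [Fintype ι] [MeasurableSpace ι]
    [MeasurableSingletonClass ι] {P : Measure[m₀] Ω} [IsFiniteMeasure P] {τ : Ω → ι}
    (hτ : Measurable τ) {F : ι → Ω → ℝ} (hF : ∀ i, UnitRV m₀ (F i)) :
    ∫ ω, F (τ ω) ω ∂P = ∑ i, ∫ ω, ind (τ ω = i) * F i ω ∂P := by
  rw [← integral_finsetSum _ fun i _ => ((UnitRV.ind_eq hτ i).mul (hF i)).integrable]
  exact integral_congr_ae (ae_of_all _ fun ω => (sum_ind_eq_mul (τ ω) fun i => F i ω).symm)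

lemma ae_eq_of_integral_mul_eq {P : Measure[m₀] Ω} [IsFiniteMeasure P] {c : ℝ}
    (hf : UnitRV m₀ f) (hg : UnitRV m₀ g) (hff : ∫ ω, f ω * f ω ∂P = c)
    (hfg : ∫ ω, f ω * g ω ∂P = c) (hgg : ∫ ω, g ω * g ω ∂P = c) : f =ᵐ[P] g := by
  have iff := (hf.mul hf).integrable (P := P)
  have ifg := ((hf.mul hg).integrable (P := P)).const_mul 2
  have igg := (hg.mul hg).integrable (P := P)
  have expand : (fun ω => (f ω - g ω) ^ 2) =
      fun ω => f ω * f ω - 2 * (f ω * g ω) + g ω * g ω := by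
    ext ω; ring
  have hi : Integrable (fun ω => (f ω - g ω) ^ 2) P := by
    rw [expand]
    exact (iff.sub ifg).add igg
  have hs : ∫ ω, (f ω - g ω) ^ 2 ∂P = 0 := by
    rw [expand, integral_add (f := fun ω => f ω * f ω - 2 * (f ω * g ω)) (iff.sub ifg) igg,
      integral_sub iff ifg, integral_const_mul, hff, hfg, hgg]
    ring
  rw [integral_eq_zero_iff_of_nonneg (fun ω => sq_nonneg _) hi] at hs
  filter_upwards [hs] with ω hω
  exact sub_eq_zero.1 (pow_eq_zero_iff two_ne_zero |>.1 hω)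

end UnitRV

section CondExp

open MeasureTheory

variable {Ω : Type*} {m m' m₀ : MeasurableSpace Ω}

/-- A version of the conditional expectation of a unit random variable which takes values in the
unit interval everywhere, not only almost everywhere. -/
noncomputable def condE (P : Measure[m₀] Ω) (m : MeasurableSpace Ω) (f : Ω → ℝ) (ω : Ω) : ℝ :=
  unitClamp ((P[f | m]) ω)

variable {P : Measure[m₀] Ω} {f g : Ω → ℝ}

lemma unitRV_condE (f : Ω → ℝ) : UnitRV m (condE P m f) :=
  .clamp stronglyMeasurable_condExp.measurable

variable [IsProbabilityMeasure P]

lemma condE_ae_eq_condExp (hm : m ≤ m₀) (hf : UnitRV m₀ f) : condE P m f =ᵐ[P] P[f | m] := by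
  have h0 : 0 ≤ᵐ[P] P[f | m] := condExp_nonneg (ae_of_all _ hf.nonneg)
  have h1 : P[f | m] ≤ᵐ[P] P[(fun _ => 1 : Ω → ℝ) | m] :=
    condExp_mono hf.integrable (integrable_const _) (ae_of_all _ hf.le_one)
  rw [condExp_const hm] at h1
  filter_upwards [h0, h1] with ω hω0 hω1
  exact unitClamp_eq_self hω0 hω1

lemma integral_condE_mul (hm : m ≤ m₀) (hf : UnitRV m₀ f) (hg : UnitRV m g) :
    ∫ ω, condE P m f ω * g ω ∂P = ∫ ω, f ω * g ω ∂P := by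
  have h := condExp_mul_of_stronglyMeasurable_right (μ := P) (f := f) hg.meas.stronglyMeasurable
    (hf.mul (hg.mono hm)).integrable hf.integrable
  rw [show ∫ ω, f ω * g ω ∂P = ∫ ω, (f * g) ω ∂P from rfl, ← integral_condExp hm (f := f * g)]
  refine integral_congr_ae ?_
  filter_upwards [h, condE_ae_eq_condExp hm hf] with ω h1 h2
  rw [h1, Pi.mul_apply, h2]

lemma integral_condE (hm : m ≤ m₀) (hf : UnitRV m₀ f) :
    ∫ ω, condE P m f ω ∂P = ∫ ω, f ω ∂P := by
  rw [← integral_condExp hm (f := f)]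
  exact integral_congr_ae (condE_ae_eq_condExp hm hf)

lemma condE_mono (hm : m ≤ m₀) (hf : UnitRV m₀ f) (hg : UnitRV m₀ g) (h : f ≤ᵐ[P] g) :
    condE P m f ≤ᵐ[P] condE P m g := by
  filter_upwards [condExp_mono (m := m) hf.integrable hg.integrable h, condE_ae_eq_condExp hm hf,
    condE_ae_eq_condExp hm hg] with ω h1 h2 h3
  rwa [h2, h3]

lemma condE_le_add {e N N' : Ω → ℝ} (hm : m ≤ m₀) (he : UnitRV m₀ e) (hN : UnitRV m₀ N)
    (hN' : UnitRV m₀ N') (h : ∀ᵐ ω ∂P, e ω ≤ N ω + N' ω) :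
    ∀ᵐ ω ∂P, condE P m e ω ≤ condE P m N ω + condE P m N' ω := by
  filter_upwards [condE_ae_eq_condExp hm he, condE_ae_eq_condExp hm hN,
    condE_ae_eq_condExp hm hN',
    condExp_mono (m := m) he.integrable (hN.integrable.add hN'.integrable) h,
    condExp_add hN.integrable hN'.integrable m] with ω h1 h2 h3 h4 h5
  rw [h1, h2, h3]
  exact h4.trans_eq h5

lemma eq_condE_of_set (hm : m ≤ m₀) (hf : UnitRV m₀ f) (hg : UnitRV m g)
    (h : ∀ s, MeasurableSet[m] s →
      ∫ ω, g ω * ind (ω ∈ s) ∂P = ∫ ω, f ω * ind (ω ∈ s) ∂P) : g =ᵐ[P] condE P m f := by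
  refine (ae_eq_condExp_of_forall_setIntegral_eq hm hf.integrable
    (fun s _ _ => (hg.mono hm).integrable.integrableOn) (fun s hs _ => ?_)
    hg.meas.stronglyMeasurable.aestronglyMeasurable).trans (condE_ae_eq_condExp hm hf).symm
  have setIntegral_eq : ∀ φ : Ω → ℝ, ∫ ω in s, φ ω ∂P = ∫ ω, φ ω * ind (ω ∈ s) ∂P := fun φ => by
    rw [← integral_indicator (hm _ hs)]
    refine integral_congr_ae (ae_of_all _ fun ω => ?_)
    by_cases hω : ω ∈ s <;> simp [hω]
  rw [setIntegral_eq, setIntegral_eq, h s hs]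

lemma eq_condE (hm : m ≤ m₀) (hf : UnitRV m₀ f) (hg : UnitRV m g)
    (h : ∀ w, UnitRV m w → ∫ ω, g ω * w ω ∂P = ∫ ω, f ω * w ω ∂P) : g =ᵐ[P] condE P m f :=
  eq_condE_of_set hm hf hg fun _ hs => h _ (.ind hs)

lemma condE_eq_of_le_of_le {k : MeasurableSpace Ω} (h1 : m ≤ k) (h2 : k ≤ m') (hm' : m' ≤ m₀)
    (hf : UnitRV m₀ f) (h : condE P m' f =ᵐ[P] condE P m f) : condE P k f =ᵐ[P] condE P m f := by
  refine (eq_condE (h2.trans hm') hf ((unitRV_condE f).mono h1) fun w hw => ?_).symm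
  rw [← integral_condE_mul hm' hf (hw.mono h2)]
  refine integral_congr_ae ?_
  filter_upwards [h] with ω hω
  rw [hω]

lemma integral_mul_condE (hm : m ≤ m₀) (hf : UnitRV m₀ f) (hg : UnitRV m₀ g) :
    ∫ ω, f ω * condE P m g ω ∂P = ∫ ω, condE P m f ω * g ω ∂P := by
  rw [← integral_condE_mul hm hf (unitRV_condE g)]
  simp only [mul_comm (condE P m f _)]
  exact integral_condE_mul hm hg (unitRV_condE f)

lemma sq_integral_le_integral_mul_condE (hm : m ≤ m₀) (hf : UnitRV m₀ f) :
    (∫ ω, f ω ∂P) ^ 2 ≤ ∫ ω, f ω * condE P m f ω ∂P := by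
  have u : UnitRV m₀ (condE P m f) := (unitRV_condE f).mono hm
  rw [← integral_condE hm hf, ← integral_condE_mul hm hf (unitRV_condE f)]
  set δ := ∫ ω, condE P m f ω ∂P with hδ
  have h : ∫ ω, (2 * δ * condE P m f ω - δ ^ 2) ∂P ≤ ∫ ω, condE P m f ω * condE P m f ω ∂P :=
    integral_mono ((u.integrable.const_mul _).sub (integrable_const _)) (u.mul u).integrable
      fun ω => by linarith [sq_nonneg (condE P m f ω - δ)]
  rw [integral_sub (u.integrable.const_mul _) (integrable_const _), integral_const_mul, ← hδ,
    integral_const, probReal_univ, one_smul] at h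
  linarith

/-- The conditional expectation over `m` of the product of `f` and `g` factors. -/
def CondUncorrelated (P : Measure[m₀] Ω) (m : MeasurableSpace Ω) (f g : Ω → ℝ) : Prop :=
  condE P m (fun ω => f ω * g ω) =ᵐ[P] fun ω => condE P m f ω * condE P m g ω

omit [IsProbabilityMeasure P] in
lemma CondUncorrelated.symm (h : CondUncorrelated P m f g) : CondUncorrelated P m g f := by
  simpa only [CondUncorrelated, mul_comm] using h

lemma condUncorrelated_of_condE_eq (hmm' : m ≤ m') (hm' : m' ≤ m₀) (hf : UnitRV m₀ f)
    (hg : UnitRV m' g) (h : condE P m' f =ᵐ[P] condE P m f) : CondUncorrelated P m f g := by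
  have hm := hmm'.trans hm'
  refine (eq_condE hm (hf.mul (hg.mono hm')) ((unitRV_condE f).mul (unitRV_condE g))
    fun w hw => ?_).symm
  calc ∫ ω, condE P m f ω * condE P m g ω * w ω ∂P
      = ∫ ω, condE P m g ω * (condE P m f ω * w ω) ∂P := by congr 1; ext ω; ring
    _ = ∫ ω, g ω * (condE P m f ω * w ω) ∂P :=
      integral_condE_mul hm (hg.mono hm') ((unitRV_condE f).mul hw)
    _ = ∫ ω, condE P m' f ω * (g ω * w ω) ∂P := by
      refine integral_congr_ae ?_
      filter_upwards [h] with ω hω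
      rw [hω]; ring
    _ = ∫ ω, f ω * (g ω * w ω) ∂P := integral_condE_mul hm' hf (hg.mul (hw.mono hmm'))
    _ = ∫ ω, f ω * g ω * w ω ∂P := by simp only [mul_assoc]

-- Writing `E[f | U] = h(U)`, equality of laws gives `E[f h(U')] = E[f h(U)]`, and hence
-- `E[h(U) h(U')] = E[h(U) ^ 2] = E[h(U') ^ 2]`.
lemma exists_condE_eq_comp_of_map_eq {E : Type*} [mE : MeasurableSpace E] {U U' : Ω → E}
    (hf : UnitRV m₀ f) (hU : Measurable U) (hU' : Measurable U')
    (hlaw : P.map (fun ω => (f ω, U ω)) = P.map fun ω => (f ω, U' ω))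
    (hle : mE.comap U' ≤ mE.comap U) :
    ∃ h, UnitRV mE h ∧ condE P (mE.comap U) f =ᵐ[P] fun ω => h (U' ω) := by
  obtain ⟨h, hh, hcond⟩ := (unitRV_condE (P := P) (m := mE.comap U) f).exists_eq_comp
  refine ⟨h, hh, ?_⟩
  have integral_law : ∀ φ : ℝ × E → ℝ, Measurable φ →
      ∫ ω, φ (f ω, U ω) ∂P = ∫ ω, φ (f ω, U' ω) ∂P := by
    intro φ hφ
    rw [← integral_map (f := φ) (hf.meas.prodMk hU).aemeasurable hφ.aestronglyMeasurable, hlaw,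
      integral_map (hf.meas.prodMk hU').aemeasurable hφ.aestronglyMeasurable]
  have uU : UnitRV (mE.comap U) fun ω => h (U ω) := hh.comp (comap_measurable U)
  have uU' : UnitRV (mE.comap U) fun ω => h (U' ω) := (hh.comp (comap_measurable U')).mono hle
  have hUU : ∫ ω, h (U ω) * h (U ω) ∂P = ∫ ω, f ω * h (U ω) ∂P := by
    rw [← integral_condE_mul hU.comap_le hf uU, hcond]
  have hUU' : ∫ ω, h (U ω) * h (U' ω) ∂P = ∫ ω, f ω * h (U ω) ∂P := by
    rw [integral_law (fun p => p.1 * h p.2) (measurable_fst.mul (hh.meas.comp measurable_snd)),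
      ← integral_condE_mul hU.comap_le hf uU', hcond]
  have hU'U' : ∫ ω, h (U' ω) * h (U' ω) ∂P = ∫ ω, f ω * h (U ω) ∂P := by
    rw [← hUU]
    exact (integral_law (fun p => h p.2 * h p.2)
      ((hh.meas.comp measurable_snd).mul (hh.meas.comp measurable_snd))).symm
  rw [hcond]
  exact ae_eq_of_integral_mul_eq (uU.mono hU.comap_le) (uU'.mono hU.comap_le) hUU hUU' hU'U'

lemma condE_comap_eq_of_map_eq {E : Type*} [mE : MeasurableSpace E] {U U' : Ω → E}
    (hf : UnitRV m₀ f) (hU : Measurable U) (hU' : Measurable U')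
    (hlaw : P.map (fun ω => (f ω, U ω)) = P.map fun ω => (f ω, U' ω))
    (h1 : mE.comap U' ≤ m) (h2 : m ≤ mE.comap U) :
    condE P (mE.comap U) f =ᵐ[P] condE P m f := by
  obtain ⟨h, hh, hcond⟩ := exists_condE_eq_comp_of_map_eq hf hU hU' hlaw (h1.trans h2)
  refine hcond.trans (eq_condE (h2.trans hU.comap_le) hf
    (hh.comp ((comap_measurable U').mono h1 le_rfl)) fun w hw => ?_)
  rw [← integral_condE_mul hU.comap_le hf (hw.mono h2)]
  refine integral_congr_ae ?_
  filter_upwards [hcond] with ω hω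
  rw [hω]

lemma tendsto_integral_condE_mul (F : Filtration ℕ m₀) (hf : UnitRV m₀ f) (hg : UnitRV m₀ g) :
    Tendsto (fun n => ∫ ω, condE P (F n) f ω * g ω ∂P) atTop
      (𝓝 (∫ ω, condE P (⨆ n, F n) f ω * g ω ∂P)) := by
  have u : ∀ n, UnitRV m₀ fun ω => condE P (F n) f ω * g ω := fun n =>
    ((unitRV_condE f).mono (F.le n)).mul hg
  refine tendsto_integral_of_dominated_convergence (fun _ => 1)
    (fun n => (u n).meas.aestronglyMeasurable) (integrable_const _)
    (fun n => ae_of_all _ fun ω => ?_) ?_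
  · rw [Real.norm_eq_abs, abs_of_nonneg ((u n).nonneg ω)]
    exact (u n).le_one ω
  · have hn : ∀ n, ∀ᵐ ω ∂P, condE P (F n) f ω = (P[f | F n]) ω := fun n =>
      condE_ae_eq_condExp (F.le n) hf
    filter_upwards [ae_all_iff.2 hn, condE_ae_eq_condExp (iSup_le F.le) hf,
      tendsto_ae_condExp (μ := P) (ℱ := F) f] with ω hω hω' hlim
    simp only [hω, hω']
    exact hlim.mul_const _

lemma tendsto_integral_condE_mul_ind (F : Filtration ℕ m₀) (h1 : m ≤ ⨆ n, F n)
    (h2 : ⨆ n, F n ≤ m') (hm' : m' ≤ m₀) (hf : UnitRV m₀ f)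
    (h : condE P m' f =ᵐ[P] condE P m f) :
    Tendsto (fun n => ∫ ω, condE P (F n) f ω * ind (condE P m f ω = 0) ∂P) atTop (𝓝 0) := by
  have hz : ∫ ω, condE P (⨆ n, F n) f ω * ind (condE P m f ω = 0) ∂P = 0 := by
    refine integral_eq_zero_of_ae ?_
    filter_upwards [condE_eq_of_le_of_le (P := P) h1 h2 hm' hf h] with ω hω
    rw [hω]
    by_cases h0 : condE P m f ω = 0 <;> simp [h0]
  have hlim := tendsto_integral_condE_mul (P := P) F hf
    ((UnitRV.ind_eq (unitRV_condE (P := P) f).meas 0).mono ((h1.trans h2).trans hm'))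
  rwa [hz] at hlim

lemma ae_condE_mul_eq_zero (hm : m ≤ m₀) (hf : UnitRV m₀ f) (hg : UnitRV m g)
    (h : ∫ ω, f ω * g ω ∂P = 0) : ∀ᵐ ω ∂P, condE P m f ω * g ω = 0 := by
  have u := ((unitRV_condE (P := P) f).mul hg).mono hm
  rwa [← integral_condE_mul hm hf hg, integral_eq_zero_iff_of_nonneg u.nonneg u.integrable] at h

-- Triangle removal: without triangles `E[e | k] e' e'' = 0`, and conditioning once more
-- `E[e | k] E[e' | k'] e'' = 0`.
lemma ae_le_ind_add_ind_of_integral_eq_zero {e e' e'' : Ω → ℝ} {k k' : MeasurableSpace Ω}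
    (hm : m ≤ m₀) (hm' : m' ≤ m₀) (he : UnitRV m₀ e) (he'₀ : UnitRV m₀ e') (he' : UnitRV m e')
    (he''m : UnitRV m e'') (he'' : UnitRV m' e'') (hk : k ≤ m')
    (h : condE P m e =ᵐ[P] condE P k e) (h' : condE P m' e' =ᵐ[P] condE P k' e')
    (h0 : ∫ ω, e ω * (e' ω * e'' ω) ∂P = 0) :
    ∀ᵐ ω ∂P, e'' ω ≤ ind (condE P k e ω = 0) + ind (condE P k' e' ω = 0) := by
  have condE_e_mul : ∀ᵐ ω ∂P, condE P m e ω * (e' ω * e'' ω) = 0 :=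
    ae_condE_mul_eq_zero hm he (he'.mul he''m) h0
  have u : UnitRV m' fun ω => ind (condE P k e ω ≠ 0) * e'' ω :=
    ((UnitRV.ind ((unitRV_condE e).meas (measurableSet_singleton 0)).compl).mono hk).mul he''
  have condE_e'_mul : ∀ᵐ ω ∂P, condE P m' e' ω * (ind (condE P k e ω ≠ 0) * e'' ω) = 0 := by
    refine ae_condE_mul_eq_zero hm' he'₀ u (integral_eq_zero_of_ae ?_)
    filter_upwards [condE_e_mul, h] with ω hω hωk
    rw [hωk] at hω
    by_cases hc : condE P k e ω = 0
    · simp [hc]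
    · simpa [hc] using hω
  filter_upwards [condE_e'_mul, h'] with ω hω hωk'
  rw [hωk'] at hω
  by_cases hc : condE P k e ω = 0
  · rw [ind_of hc]
    linarith [he''.le_one ω, ind_nonneg (condE P k' e' ω = 0)]
  by_cases hc' : condE P k' e' ω = 0
  · rw [ind_of hc']
    linarith [he''.le_one ω, ind_nonneg (condE P k e ω = 0)]
  have hz : e'' ω = 0 := by simpa [hc, hc'] using hω
  rw [hz]
  exact add_nonneg (ind_nonneg _) (ind_nonneg _)

end CondExp

section CondExpOnCells

open MeasureTheory

variable {Ω : Type*} {m m₀ : MeasurableSpace Ω}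

lemma exists_of_measurableSet_sup_comap {ι : Type*} [mι : MeasurableSpace ι] {τ : Ω → ι}
    {s : Set Ω} (hs : MeasurableSet[m ⊔ mι.comap τ] s) :
    ∃ h : ι → Set Ω, (∀ i, MeasurableSet[m] (h i)) ∧ s = {ω | ω ∈ h (τ ω)} := by
  let n : MeasurableSpace Ω :=
    { MeasurableSet' := fun s => ∃ h : ι → Set Ω, (∀ i, MeasurableSet[m] (h i)) ∧
        s = {ω | ω ∈ h (τ ω)}
      measurableSet_empty := ⟨fun _ => ∅, fun _ => @MeasurableSet.empty _ m, rfl⟩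
      measurableSet_compl := by
        rintro _ ⟨h, hh, rfl⟩
        exact ⟨fun i => (h i)ᶜ, fun i => (hh i).compl, rfl⟩
      measurableSet_iUnion := by
        intro F hF
        choose h hh hs using hF
        refine ⟨fun i => ⋃ k, h k i, fun i => .iUnion fun k => hh k i, ?_⟩
        ext ω
        simp [hs] }
  have hle : m ⊔ mι.comap τ ≤ n := by
    refine sup_le (fun s hs => ⟨fun _ => s, fun _ => hs, rfl⟩) ?_
    rintro _ ⟨t, -, rfl⟩
    exact ⟨fun i => {_ω | i ∈ t}, fun i => @MeasurableSet.const _ m _, rfl⟩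
  exact hle s hs

/-- The conditional expectation `E[f | m, τ = i]` of `f` over `m` on the cell `τ = i` of a random
variable `τ` with finitely many values, with value `0` where the cell has conditional probability
`0`. -/
noncomputable def condEOn {ι : Type*} (P : Measure[m₀] Ω) (m : MeasurableSpace Ω) (τ : Ω → ι)
    (f : Ω → ℝ) (i : ι) (ω : Ω) : ℝ :=
  unitClamp (condE P m (fun ω => ind (τ ω = i) * f ω) ω / condE P m (fun ω => ind (τ ω = i)) ω)

variable {P : Measure[m₀] Ω} {ι : Type*} {τ τ' : Ω → ι} {e f g : Ω → ℝ}

lemma unitRV_condEOn (i : ι) : UnitRV m (condEOn P m τ f i) :=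
  .clamp ((unitRV_condE _).meas.div (unitRV_condE _).meas)

variable [IsProbabilityMeasure P] [MeasurableSpace ι] [MeasurableSingletonClass ι]

lemma condEOn_mul_condE_ind (hm : m ≤ m₀) (hτ : Measurable τ) (hf : UnitRV m₀ f) (i : ι) :
    ∀ᵐ ω ∂P, condEOn P m τ f i ω * condE P m (fun ω => ind (τ ω = i)) ω =
      condE P m (fun ω => ind (τ ω = i) * f ω) ω := by
  have u := UnitRV.ind_eq hτ i
  filter_upwards [condE_mono (P := P) hm (u.mul hf) u (ae_of_all _ fun ω =>
    mul_le_of_le_one_right (u.nonneg ω) (hf.le_one ω))] with ω hω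
  exact unitClamp_div_mul ((unitRV_condE _).nonneg ω) hω

variable [Finite ι]

lemma condEOn_apply_ae_eq_condE_sup (hm : m ≤ m₀) (hτ : Measurable τ) (hf : UnitRV m₀ f) :
    (fun ω => condEOn P m τ f (τ ω) ω) =ᵐ[P]
      condE P (m ⊔ MeasurableSpace.comap τ inferInstance) f := by
  have := Fintype.ofFinite ι
  have hu : UnitRV (m ⊔ MeasurableSpace.comap τ inferInstance) fun ω =>
      condEOn P m τ f (τ ω) ω := by
    refine .apply_of_countable ?_ fun i => (unitRV_condEOn i).mono le_sup_left
    exact (comap_measurable τ).mono le_sup_right le_rfl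
  refine eq_condE_of_set (sup_le hm hτ.comap_le) hf hu fun s hs => ?_
  obtain ⟨h, hh, rfl⟩ := exists_of_measurableSet_sup_comap hs
  have uh : ∀ i, UnitRV m fun ω => ind (ω ∈ h i) := fun i => .ind (hh i)
  have uτ : ∀ i, UnitRV m₀ fun ω => ind (τ ω = i) := fun i => .ind_eq hτ i
  refine (integral_apply_eq_sum hτ (F := fun i ω => condEOn P m τ f i ω * ind (ω ∈ h i))
    fun i => ((unitRV_condEOn i).mul (uh i)).mono hm).trans (Eq.trans ?_
    (integral_apply_eq_sum hτ (F := fun i ω => f ω * ind (ω ∈ h i))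
      fun i => hf.mul ((uh i).mono hm)).symm)
  refine Finset.sum_congr rfl fun i _ => ?_
  calc ∫ ω, ind (τ ω = i) * (condEOn P m τ f i ω * ind (ω ∈ h i)) ∂P
      = ∫ ω, condE P m (fun ω => ind (τ ω = i)) ω *
          (condEOn P m τ f i ω * ind (ω ∈ h i)) ∂P :=
        (integral_condE_mul hm (uτ i) ((unitRV_condEOn i).mul (uh i))).symm
    _ = ∫ ω, condE P m (fun ω => ind (τ ω = i) * f ω) ω * ind (ω ∈ h i) ∂P := by
        refine integral_congr_ae ?_
        filter_upwards [condEOn_mul_condE_ind hm hτ hf i] with ω hω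
        rw [← hω]; ring
    _ = ∫ ω, ind (τ ω = i) * (f ω * ind (ω ∈ h i)) ∂P := by
        simp only [integral_condE_mul hm ((uτ i).mul hf) (uh i), mul_assoc]

/-- Over `m`, the pair `(f, τ')` has the same conditional distribution as `(e, τ)`, as far as
expectations linear in the first component are concerned. -/
structure SameCellLaw (P : Measure[m₀] Ω) (m : MeasurableSpace Ω) (f : Ω → ℝ) (τ' : Ω → ι)
    (e : Ω → ℝ) (τ : Ω → ι) : Prop where
  left : UnitRV m₀ f
  right : UnitRV m₀ e
  left_cell : Measurable[m₀] τ'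
  right_cell : Measurable[m₀] τ
  integral_eq : ∀ i g, UnitRV m g →
    ∫ ω, f ω * ind (τ' ω = i) * g ω ∂P = ∫ ω, e ω * ind (τ ω = i) * g ω ∂P

namespace SameCellLaw

lemma integral_apply_eq (h : SameCellLaw P m f τ' e τ) (hm : m ≤ m₀) {F : ι → Ω → ℝ}
    (hF : ∀ i, UnitRV m (F i)) :
    ∫ ω, f ω * F (τ' ω) ω ∂P = ∫ ω, e ω * F (τ ω) ω ∂P := by
  have := Fintype.ofFinite ι
  rw [integral_apply_eq_sum h.left_cell (F := fun i ω => f ω * F i ω)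
    fun i => h.left.mul ((hF i).mono hm),
    integral_apply_eq_sum h.right_cell (F := fun i ω => e ω * F i ω)
    fun i => h.right.mul ((hF i).mono hm)]
  refine Finset.sum_congr rfl fun i _ => ?_
  simpa only [mul_assoc, mul_left_comm (ind _)] using h.integral_eq i _ (hF i)

lemma integral_mul_condEOn_apply (h : SameCellLaw P m f τ' e τ) (hm : m ≤ m₀)
    (hg : UnitRV m₀ g) :
    ∫ ω, f ω * condEOn P m τ g (τ' ω) ω ∂P =
      ∫ ω, e ω * condE P (m ⊔ MeasurableSpace.comap τ inferInstance) g ω ∂P := by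
  rw [h.integral_apply_eq hm fun i => unitRV_condEOn i]
  refine integral_congr_ae ?_
  filter_upwards [condEOn_apply_ae_eq_condE_sup (P := P) hm h.right_cell hg] with ω hω
  rw [hω]

lemma ae_condE_ind_pos (h : SameCellLaw P m f τ' e τ) (hm : m ≤ m₀) :
    ∀ᵐ ω ∂P, f ω ≠ 0 → 0 < condE P m (fun ω' => ind (τ ω' = τ' ω)) ω := by
  have := Fintype.ofFinite ι
  let Z : ι → Ω → ℝ := fun i ω => ind (condE P m (fun ω => ind (τ ω = i)) ω = 0)
  have uZ : ∀ i, UnitRV m (Z i) := fun i => .ind_eq (unitRV_condE _).meas 0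
  have uZτ : UnitRV m₀ fun ω => Z (τ ω) ω :=
    .apply_of_countable h.right_cell fun i => (uZ i).mono hm
  have uZτ' : UnitRV m₀ fun ω => Z (τ' ω) ω :=
    .apply_of_countable h.left_cell fun i => (uZ i).mono hm
  have hτ : ∫ ω, Z (τ ω) ω ∂P = 0 := by
    rw [integral_apply_eq_sum h.right_cell fun i => (uZ i).mono hm]
    refine Finset.sum_eq_zero fun i _ => ?_
    rw [← integral_condE_mul hm (.ind_eq h.right_cell i) (uZ i)]
    refine integral_eq_zero_of_ae (ae_of_all _ fun ω => ?_)
    by_cases h : condE P m (fun ω => ind (τ ω = i)) ω = 0 <;> simp [Z, h]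
  have hτ' : ∫ ω, f ω * Z (τ' ω) ω ∂P = 0 := by
    rw [h.integral_apply_eq hm uZ]
    refine le_antisymm (hτ ▸ integral_mono (h.right.mul uZτ).integrable uZτ.integrable fun ω => ?_)
      (integral_nonneg (h.right.mul uZτ).nonneg)
    exact mul_le_of_le_one_left (uZτ.nonneg ω) (h.right.le_one ω)
  rw [integral_eq_zero_iff_of_nonneg (h.left.mul uZτ').nonneg (h.left.mul uZτ').integrable] at hτ'
  filter_upwards [hτ'] with ω hω hf
  refine ((unitRV_condE _).nonneg ω).lt_of_ne' fun h0 => hf ?_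
  simpa [Z, h0] using hω

end SameCellLaw

end CondExpOnCells

section Counting

open MeasureTheory

variable {Ω : Type*} {m m₀ : MeasurableSpace Ω} {P : Measure[m₀] Ω} {ι : Type*}
  [MeasurableSpace ι] [MeasurableSingletonClass ι]
  {A B C A' B' C' : Ω → ι} {e e' e'' f N N' : Ω → ℝ}

/-- The independence, over `m`, needed to count triangles on finite-valued vertex cells `A`, `B`
and `C`: the cells are pairwise independent, and each cell is independent of the pair of the other
two together with a random variable `e`, `N` or `N'` attached to the opposite edge. -/
structure IndepTriangle (P : Measure[m₀] Ω) (m : MeasurableSpace Ω) (A B C : Ω → ι)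
    (e N N' : Ω → ℝ) : Prop where
  meas_A : Measurable[m₀] A
  meas_B : Measurable[m₀] B
  meas_C : Measurable[m₀] C
  unit_BC : UnitRV m₀ e
  unit_AB : UnitRV m₀ N
  unit_AC : UnitRV m₀ N'
  indep_AB i j : CondUncorrelated P m (fun ω => ind (A ω = i)) fun ω => ind (B ω = j)
  indep_AC i j : CondUncorrelated P m (fun ω => ind (A ω = i)) fun ω => ind (C ω = j)
  indep_BC i j : CondUncorrelated P m (fun ω => ind (B ω = i)) fun ω => ind (C ω = j)
  indep_A_BC i p : CondUncorrelated P m (fun ω => ind ((B ω, C ω) = p) * e ω)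
    fun ω => ind (A ω = i)
  indep_C_AB i p : CondUncorrelated P m (fun ω => ind ((A ω, B ω) = p) * N ω)
    fun ω => ind (C ω = i)
  indep_B_AC i p : CondUncorrelated P m (fun ω => ind ((A ω, C ω) = p) * N' ω)
    fun ω => ind (B ω = i)

omit [MeasurableSpace ι] [MeasurableSingletonClass ι] in
lemma condE_ind_pair_ae_eq {i j : ι}
    (h : CondUncorrelated P m (fun ω => ind (A ω = i)) fun ω => ind (B ω = j)) :
    condE P m (fun ω => ind ((A ω, B ω) = (i, j))) =ᵐ[P] fun ω =>
      condE P m (fun ω => ind (A ω = i)) ω * condE P m (fun ω => ind (B ω = j)) ω := by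
  simp only [Prod.mk_inj, ind_and]
  exact h

variable [IsProbabilityMeasure P]

lemma IndepTriangle.condE_mul_le_add (h : IndepTriangle P m A B C e N N') (hm : m ≤ m₀)
    (hle : ∀ᵐ ω ∂P, e ω ≤ N ω + N' ω) (i j k : ι) : ∀ᵐ ω ∂P,
      condE P m (fun ω => ind ((B ω, C ω) = (j, k)) * e ω) ω *
          condE P m (fun ω => ind (A ω = i)) ω ≤
        condE P m (fun ω => ind ((A ω, B ω) = (i, j)) * N ω) ω *
          condE P m (fun ω => ind (C ω = k)) ω +
        condE P m (fun ω => ind ((A ω, C ω) = (i, k)) * N' ω) ω *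
          condE P m (fun ω => ind (B ω = j)) ω := by
  have uA := UnitRV.ind_eq h.meas_A i
  have uB := UnitRV.ind_eq h.meas_B j
  have uC := UnitRV.ind_eq h.meas_C k
  have uBC := UnitRV.ind_eq (h.meas_B.prodMk h.meas_C) (j, k)
  have uAB := UnitRV.ind_eq (h.meas_A.prodMk h.meas_B) (i, j)
  have uAC := UnitRV.ind_eq (h.meas_A.prodMk h.meas_C) (i, k)
  have hcell : ∀ᵐ ω ∂P, ind ((B ω, C ω) = (j, k)) * e ω * ind (A ω = i) ≤
      ind ((A ω, B ω) = (i, j)) * N ω * ind (C ω = k) +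
        ind ((A ω, C ω) = (i, k)) * N' ω * ind (B ω = j) := by
    filter_upwards [hle] with ω hω
    simp only [Prod.mk_inj, ind_and]
    linarith [mul_le_mul_of_nonneg_left hω ((uA.mul (uB.mul uC)).nonneg ω)]
  filter_upwards [h.indep_A_BC i (j, k), h.indep_C_AB k (i, j), h.indep_B_AC j (i, k),
    condE_le_add hm ((uBC.mul h.unit_BC).mul uA) ((uAB.mul h.unit_AB).mul uC)
      ((uAC.mul h.unit_AC).mul uB) hcell] with ω hBC hAB hAC hadd
  rwa [hBC, hAB, hAC] at hadd

lemma IndepTriangle.condEOn_le_add (h : IndepTriangle P m A B C e N N') (hm : m ≤ m₀)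
    (hle : ∀ᵐ ω ∂P, e ω ≤ N ω + N' ω) (i j k : ι) : ∀ᵐ ω ∂P,
      0 < condE P m (fun ω => ind ((A ω, B ω) = (i, j))) ω →
      0 < condE P m (fun ω => ind ((B ω, C ω) = (j, k))) ω →
      condEOn P m (fun ω => (B ω, C ω)) e (j, k) ω ≤
        condEOn P m (fun ω => (A ω, B ω)) N (i, j) ω +
          condEOn P m (fun ω => (A ω, C ω)) N' (i, k) ω := by
  filter_upwards [h.condE_mul_le_add hm hle i j k,
    condE_ind_pair_ae_eq (h.indep_AB i j), condE_ind_pair_ae_eq (h.indep_AC i k),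
    condE_ind_pair_ae_eq (h.indep_BC j k),
    condEOn_mul_condE_ind hm (h.meas_A.prodMk h.meas_B) h.unit_AB (i, j),
    condEOn_mul_condE_ind hm (h.meas_A.prodMk h.meas_C) h.unit_AC (i, k),
    condEOn_mul_condE_ind hm (h.meas_B.prodMk h.meas_C) h.unit_BC (j, k)]
    with ω hadd hAB hAC hBC qAB qAC qBC posAB posBC
  rw [hAB] at qAB posAB
  rw [hAC] at qAC
  rw [hBC] at qBC posBC
  rw [← qAB, ← qAC, ← qBC] at hadd
  have hB := (unitRV_condE (P := P) (m := m) fun ω => ind (B ω = j)).nonneg ω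
  have hBC' := pos_of_mul_pos_right posBC hB
  refine le_of_mul_le_mul_left ?_ (mul_pos posAB hBC')
  linarith

variable [Finite ι]

lemma IndepTriangle.mul_condEOn_le_add (h : IndepTriangle P m A B C e'' N N') (hm : m ≤ m₀)
    (hle : ∀ᵐ ω ∂P, e'' ω ≤ N ω + N' ω)
    (lAB : SameCellLaw P m f (fun ω => (A' ω, B' ω)) e fun ω => (A ω, B ω))
    (lBC : SameCellLaw P m f (fun ω => (B' ω, C' ω)) e'' fun ω => (B ω, C ω)) :
    ∀ᵐ ω ∂P, f ω * condEOn P m (fun ω => (B ω, C ω)) e'' (B' ω, C' ω) ω ≤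
      f ω * condEOn P m (fun ω => (A ω, B ω)) N (A' ω, B' ω) ω +
        f ω * condEOn P m (fun ω => (A ω, C ω)) N' (A' ω, C' ω) ω := by
  have hcells := h.condEOn_le_add hm hle
  simp only [← ae_all_iff] at hcells
  filter_upwards [hcells, lAB.ae_condE_ind_pos hm, lBC.ae_condE_ind_pos hm] with ω hω posAB posBC
  rcases eq_or_ne (f ω) 0 with hf | hf
  · simp [hf]
  rw [← mul_add]
  exact mul_le_mul_of_nonneg_left (hω _ _ _ (posAB hf) (posBC hf)) (lAB.left.nonneg ω)

-- The three edges of the counted triangle coincide at the independent sample `(f, A', B', C')`,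
-- so the inequality between the densities on cells can be integrated against `f` alone.
lemma IndepTriangle.sq_integral_le (h : IndepTriangle P m A B C e'' N N') (hm : m ≤ m₀)
    (hle : ∀ᵐ ω ∂P, e'' ω ≤ N ω + N' ω)
    (lAB : SameCellLaw P m f (fun ω => (A' ω, B' ω)) e fun ω => (A ω, B ω))
    (lAC : SameCellLaw P m f (fun ω => (A' ω, C' ω)) e' fun ω => (A ω, C ω))
    (lBC : SameCellLaw P m f (fun ω => (B' ω, C' ω)) e'' fun ω => (B ω, C ω)) :
    (∫ ω, e'' ω ∂P) ^ 2 ≤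
      ∫ ω, condE P (m ⊔ MeasurableSpace.comap (fun ω => (A ω, B ω)) inferInstance) e ω * N ω ∂P +
      ∫ ω, condE P (m ⊔ MeasurableSpace.comap (fun ω => (A ω, C ω)) inferInstance) e' ω *
        N' ω ∂P := by
  have integrable_at : ∀ {X Y X' Y' : Ω → ι} {M d : Ω → ℝ},
      SameCellLaw P m f (fun ω => (X' ω, Y' ω)) d (fun ω => (X ω, Y ω)) →
      Integrable (fun ω => f ω * condEOn P m (fun ω => (X ω, Y ω)) M (X' ω, Y' ω) ω) P :=
    fun {X Y _ _ M _} l => (l.left.mul (.apply_of_countable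
      (F := condEOn P m (fun ω => (X ω, Y ω)) M) l.left_cell fun p =>
        (unitRV_condEOn p).mono hm)).integrable
  have hAB := sup_le hm (h.meas_A.prodMk h.meas_B).comap_le
  have hAC := sup_le hm (h.meas_A.prodMk h.meas_C).comap_le
  have hBC := sup_le hm (h.meas_B.prodMk h.meas_C).comap_le
  calc (∫ ω, e'' ω ∂P) ^ 2
      ≤ ∫ ω, f ω * condEOn P m (fun ω => (B ω, C ω)) e'' (B' ω, C' ω) ω ∂P := by
        rw [lBC.integral_mul_condEOn_apply hm lBC.right]
        exact sq_integral_le_integral_mul_condE hBC lBC.right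
    _ ≤ ∫ ω, f ω * condEOn P m (fun ω => (A ω, B ω)) N (A' ω, B' ω) ω ∂P +
          ∫ ω, f ω * condEOn P m (fun ω => (A ω, C ω)) N' (A' ω, C' ω) ω ∂P := by
        rw [← integral_add (integrable_at lAB) (integrable_at lAC)]
        exact integral_mono_ae (integrable_at lBC)
          ((integrable_at lAB).add (integrable_at lAC)) (h.mul_condEOn_le_add hm hle lAB lBC)
    _ = _ := by
        rw [lAB.integral_mul_condEOn_apply hm h.unit_AB,
          lAC.integral_mul_condEOn_apply hm h.unit_AC,
          integral_mul_condE hAB lAB.right h.unit_AB, integral_mul_condE hAC lAC.right h.unit_AC]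

end Counting

section TupleMean

variable {X : Type*} (m : Mean X)

/-- The iterated mean of tuples, outermost in the first entry. -/
def tupleMean : (n : ℕ) → Mean (Fin n → X)
  | 0 => .dirac Fin.elim0
  | n + 1 => m.bind fun x => (tupleMean n).map fun v => (Fin.cons x v : Fin (n + 1) → X)

lemma tupleMean_zero (F : (Fin 0 → X) → ℝ) : tupleMean m 0 F = F Fin.elim0 := rfl

lemma tupleMean_succ (n : ℕ) (F : (Fin (n + 1) → X) → ℝ) :
    tupleMean m (n + 1) F = m fun x => tupleMean m n fun v => F (Fin.cons x v) := rfl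

lemma exists_eq_succ_comp_of_strictMono {k n : ℕ} {s : Fin k → Fin (n + 1)} (hs : StrictMono s)
    (h : ∀ i, s i ≠ 0) : ∃ s' : Fin k → Fin n, StrictMono s' ∧ s = Fin.succ ∘ s' :=
  ⟨fun i => (s i).pred (h i), fun i j hij => by simpa using hs hij, by ext1 i; simp⟩

lemma exists_eq_cons_zero_succ_comp_of_strictMono {k n : ℕ} {s : Fin (k + 1) → Fin (n + 1)}
    (hs : StrictMono s) (h : s 0 = 0) :
    ∃ s' : Fin k → Fin n, StrictMono s' ∧ s = Fin.cons 0 (Fin.succ ∘ s') := by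
  obtain ⟨s', hs', hss⟩ := exists_eq_succ_comp_of_strictMono
    (hs.comp (Fin.strictMono_succ (n := k))) fun i =>
      (h ▸ hs (Fin.succ_pos i) : (0 : Fin (n + 1)) < s i.succ).ne'
  exact ⟨s', hs', by rw [← hss, ← h]; exact (Fin.cons_self_tail s).symm⟩

lemma tupleMean_comp {k n : ℕ} {s : Fin k → Fin n} (hs : StrictMono s) (F : (Fin k → X) → ℝ) :
    tupleMean m n (fun v => F (v ∘ s)) = tupleMean m k F := by
  induction n generalizing k with
  | zero =>
    cases k with
    | zero => exact congrArg F (Subsingleton.elim _ _)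
    | succ k => exact (s 0).elim0
  | succ n ih =>
    by_cases h : ∀ i, s i ≠ 0
    · obtain ⟨s', hs', rfl⟩ := exists_eq_succ_comp_of_strictMono hs h
      exact (congrArg m.toFun (funext fun _ => ih hs' F)).trans (m.const _)
    · push Not at h
      obtain ⟨i, hi⟩ := h
      cases k with
      | zero => exact i.elim0
      | succ k =>
        obtain ⟨s', hs', rfl⟩ := exists_eq_cons_zero_succ_comp_of_strictMono hs
          (le_antisymm (hi ▸ hs.monotone (Fin.zero_le i)) (Fin.zero_le _))
        simp only [tupleMean_succ, Fin.comp_cons, Fin.cons_zero, ← ih hs']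
        rfl

lemma tupleMean_apply {n : ℕ} (i : Fin n) (F : X → ℝ) :
    tupleMean m n (fun v => F (v i)) = m F :=
  tupleMean_comp m (s := fun _ : Fin 1 => i) (Subsingleton.strictMono _) fun v => F (v 0)

lemma tupleMean_map {Y : Type*} {m' : Mean Y} {n : ℕ} {θ : Fin n → X → Y}
    (hθ : ∀ i f, BddFun f → m (fun x => f (θ i x)) = m' f) {F : (Fin n → Y) → ℝ} (hF : BddFun F) :
    tupleMean m n (fun v => F fun i => θ i (v i)) = tupleMean m' n F := by
  induction n with
  | zero => exact congrArg F (Subsingleton.elim _ _)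
  | succ n ih =>
    have hcons : ∀ x (v : Fin n → X), (fun i => θ i ((Fin.cons x v : Fin (n + 1) → X) i)) =
        Fin.cons (θ 0 x) fun i => θ i.succ (v i) := fun x v =>
      funext fun i => Fin.cases rfl (fun _ => rfl) i
    simp only [tupleMean_succ, hcons, ih (fun i => hθ i.succ) (hF.comp _)]
    exact hθ 0 (fun x => tupleMean m' n fun v => F (Fin.cons x v))
      (Mean.bddFun (hF.imp fun C hC _ _ => hC _))

end TupleMean

section ArrayMean

variable {X T : Type*} [LinearOrder T] (m : Mean X) (x₀ : X)

/-- The mean of arrays indexed by a linear order that integrates out later times first. It is the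
limit of the iterated means over finite sets of times; the entries at other times are set to `x₀`,
which is irrelevant in the limit. -/
noncomputable def arrayMean : Mean (T → X) :=
  .ulim (Ultrafilter.of atTop) fun K : Finset T =>
    (tupleMean m K.card).map fun v => extend (K.orderEmbOfFin rfl) v fun _ => x₀

lemma arrayMean_comp_eq_tupleMean {k : ℕ} {t : Fin k → T} (ht : StrictMono t)
    (F : (Fin k → X) → ℝ) : arrayMean m x₀ (fun v => F (v ∘ t)) = tupleMean m k F := by
  refine Mean.ulim_eq <| Ultrafilter.of_le atTop <|
    (eventually_ge_atTop (Finset.univ.image t)).mono fun K hK => ?_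
  have hmem : ∀ i, ∃ j, K.orderEmbOfFin rfl j = t i := fun i => by
    rw [← Set.mem_range, Finset.range_orderEmbOfFin]
    exact hK (Finset.mem_image_of_mem _ (Finset.mem_univ i))
  choose s hs using hmem
  obtain rfl : K.orderEmbOfFin rfl ∘ s = t := funext hs
  have hs' : StrictMono s := fun i j hij => (K.orderEmbOfFin rfl).lt_iff_lt.1 (ht hij)
  rw [← tupleMean_comp m hs' F]
  refine congrArg (tupleMean m K.card).toFun (funext fun v => congrArg F (funext fun i => ?_))
  exact (K.orderEmbOfFin rfl).injective.extend_apply v (fun _ => x₀) (s i)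

lemma apply_eq_apply_extend_of_dependsOn {F : (T → X) → ℝ} {K : Finset T} (h : DependsOn F K)
    (v : T → X) :
    F v = F (extend (K.orderEmbOfFin rfl) (v ∘ K.orderEmbOfFin rfl) fun _ => x₀) := by
  refine h fun t ht => ?_
  rw [← Finset.range_orderEmbOfFin K rfl] at ht
  obtain ⟨i, rfl⟩ := ht
  exact ((K.orderEmbOfFin rfl).injective.extend_apply
    (v ∘ K.orderEmbOfFin rfl) (fun _ => x₀) i).symm

variable {m x₀} {F : (T → X) → ℝ} {K : Finset T}

lemma arrayMean_eq_tupleMean (h : DependsOn F K) :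
    arrayMean m x₀ F = tupleMean m K.card fun v =>
      F (extend (K.orderEmbOfFin rfl) v fun _ => x₀) := by
  rw [← arrayMean_comp_eq_tupleMean m x₀ (K.orderEmbOfFin rfl).strictMono]
  exact congrArg _ (funext (apply_eq_apply_extend_of_dependsOn x₀ h))

lemma arrayMean_comp (h : DependsOn F K) {r : T → T} (hr : StrictMono r) :
    arrayMean m x₀ (fun v => F (v ∘ r)) = arrayMean m x₀ F := by
  rw [arrayMean_eq_tupleMean h,
    ← arrayMean_comp_eq_tupleMean m x₀ (hr.comp (K.orderEmbOfFin rfl).strictMono)]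
  exact congrArg _ (funext fun v => apply_eq_apply_extend_of_dependsOn x₀ h (v ∘ r))

lemma arrayMean_map (h : DependsOn F K) (hF : BddFun F) {θ : X → X}
    (hθ : ∀ f, BddFun f → m (fun x => f (θ x)) = m f) :
    arrayMean m x₀ (fun v => F (θ ∘ v)) = arrayMean m x₀ F := by
  have h' : DependsOn (fun v => F (θ ∘ v)) (K : Set T) := fun v v' hv =>
    h fun t ht => congrArg θ (hv t ht)
  rw [arrayMean_eq_tupleMean h', arrayMean_eq_tupleMean h,
    ← tupleMean_map m (fun _ => hθ)
      (hF.comp fun v => extend (K.orderEmbOfFin rfl) v fun _ => x₀)]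
  refine congrArg _ (funext fun v => h fun t ht => ?_)
  rw [← Finset.range_orderEmbOfFin K rfl] at ht
  obtain ⟨i, rfl⟩ := ht
  simp only [comp_apply, (K.orderEmbOfFin rfl).injective.extend_apply]

lemma arrayMean_apply_eq {H : X → (T → X) → ℝ} (h : ∀ x, DependsOn (H x) K) {t : T}
    (ht : ∀ s ∈ K, t < s) :
    arrayMean m x₀ (fun v => H (v t) v) = m fun x => arrayMean m x₀ (H x) := by
  have hs : StrictMono (Fin.cons t (K.orderEmbOfFin rfl) : Fin (K.card + 1) → T) :=
    fun i j => Fin.cases (fun h => absurd h (Fin.not_lt_zero i)) (fun j =>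
      Fin.cases (fun _ => ht _ (K.orderEmbOfFin_mem rfl j))
        (fun i h => (K.orderEmbOfFin rfl).strictMono (Fin.succ_lt_succ_iff.1 h)) i) j
  calc arrayMean m x₀ (fun v => H (v t) v)
      = arrayMean m x₀ fun v => H (v t)
          (extend (K.orderEmbOfFin rfl) (v ∘ K.orderEmbOfFin rfl) fun _ => x₀) :=
        congrArg _ (funext fun v => apply_eq_apply_extend_of_dependsOn x₀ (h _) v)
    _ = tupleMean m (K.card + 1) fun w => H (w 0)
          (extend (K.orderEmbOfFin rfl) (Fin.tail w) fun _ => x₀) :=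
        arrayMean_comp_eq_tupleMean m x₀ hs fun w => H (w 0)
          (extend (K.orderEmbOfFin rfl) (Fin.tail w) fun _ => x₀)
    _ = m fun x => arrayMean m x₀ (H x) := by
        simp only [tupleMean_succ, Fin.cons_zero, Fin.tail_cons, arrayMean_eq_tupleMean (h _)]

lemma arrayMean_comp_front_eq {n : ℕ} {H : (Fin n → X) → (T → X) → ℝ}
    (h : ∀ w, DependsOn (H w) K) {t : Fin n → T} (ht : StrictMono t) (htK : ∀ i, ∀ s ∈ K, t i < s) :
    arrayMean m x₀ (fun v => H (v ∘ t) v) = tupleMean m n fun w => arrayMean m x₀ (H w) := by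
  induction n with
  | zero => exact congrArg _ (funext fun v => congrArg (H · v) (Subsingleton.elim _ _))
  | succ n ih =>
    have hcomp : ∀ v : T → X, v ∘ t = Fin.cons (v (t 0)) (v ∘ Fin.tail t) := fun v =>
      (Fin.cons_self_tail (v ∘ t)).symm
    have hdep : ∀ x, DependsOn (fun v => H (Fin.cons x (v ∘ Fin.tail t)) v)
        (Finset.univ.image (Fin.tail t) ∪ K : Finset T) := fun x v v' hv => by
      have htail : v ∘ Fin.tail t = v' ∘ Fin.tail t := funext fun i => hv _ (by simp)
      simp only [htail]
      exact h _ fun s hs => hv s (by simp [show s ∈ K from hs])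
    simp only [hcomp, tupleMean_succ]
    rw [arrayMean_apply_eq hdep fun s hs => ?_]
    · exact congrArg _ (funext fun x => ih (fun w => h (Fin.cons x w))
        (ht.comp (Fin.strictMono_succ (n := n))) fun i => htK i.succ)
    · rcases Finset.mem_union.1 hs with hs | hs
      · obtain ⟨i, -, rfl⟩ := Finset.mem_image.1 hs
        exact ht (Fin.succ_pos i)
      · exact htK 0 s hs

end ArrayMean

section BiSystem

/-- Invariance of a mean on a group under left and right translations. -/
structure Mean.IsInvariant {G : Type*} [Group G] (I : Mean G) : Prop where
  mul_left : ∀ (g : G) {f : G → ℝ}, BddFun f → I (fun x => f (g * x)) = I f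
  mul_right : ∀ (g : G) {f : G → ℝ}, BddFun f → I (fun x => f (x * g)) = I f

/-- A mean-preserving action `z ↦ p z q` of a group from the left and from the right. -/
structure BiSystem (G Z : Type*) [Group G] where
  act : G → G → Z → Z
  act_one : ∀ z, act 1 1 z = z
  act_act : ∀ p q p' q' z, act p q (act p' q' z) = act (p * p') (q' * q) z
  mean : Mean Z
  mean_act : ∀ p q f, BddFun f → mean (fun z => f (act p q z)) = mean f

variable {G Z κ : Type*} [Group G]

lemma Mean.IsInvariant.mul_mul {I : Mean G} (hI : I.IsInvariant) (p q : G) {F : G → ℝ}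
    (hF : BddFun F) : I (fun x => F (p * x * q)) = I F :=
  (hI.mul_left p (f := fun x => F (x * q)) (hF.comp _)).trans (hI.mul_right q hF)

section EdgeValues

variable (S : BiSystem G Z) (f : Z → Bool)

/-- The value of an edge joining two vertices, given by their classes and labels and in increasing
order of the classes. Pairs that are no edges of the tripartite graph get the value `true`. -/
def orientedVal (z : Z) : Fin 3 × G → Fin 3 × G → Bool
  | (0, a), (1, b) => f (S.act a b⁻¹ z)
  | (0, a), (2, c) => f (S.act a (c * a⁻¹) z)
  | (1, b), (2, c) => f (S.act (b * c) b⁻¹ z)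
  | _, _ => true

/-- The value of an edge of the tripartite graph of corners, whose vertices are pairs of a class and
a label. The edges of the triangle with labels `1, 1, g` have the values of `f` at `z`, `z g` and
`g z`. -/
def edgeVal (z : Z) : Sym2 (Fin 3 × G) → Bool :=
  Sym2.lift ⟨fun x y => orientedVal S f z x y && orientedVal S f z y x,
    fun _ _ => Bool.and_comm _ _⟩

/-- The symmetries of the labels of the three classes: they turn the value of an edge at `z` into
the one at `p z q⁻¹`. -/
def twist (p q : G) (i : Fin 3) (g : G) : G :=
  (![1, 1, q] : Fin 3 → G) i * g * (![p⁻¹, q⁻¹, p⁻¹] : Fin 3 → G) i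

lemma edgeVal_twist (p q : G) (z : Z) (e : Sym2 (Fin 3 × G)) :
    edgeVal S f (S.act p q⁻¹ z) (e.map fun x => (x.1, twist p q x.1 x.2)) = edgeVal S f z e := by
  induction e with | _ x y
  obtain ⟨i, a⟩ := x
  obtain ⟨j, b⟩ := y
  fin_cases i <;> fin_cases j <;>
    simp [edgeVal, orientedVal, twist, S.act_act, mul_assoc]

/-- The probability that finitely many edges with given labels have prescribed values. -/
noncomputable def matchProb (e : κ → Sym2 (Fin 3 × G)) (K : Finset κ) (p : κ → Bool) : ℝ :=
  S.mean fun z => ind (∀ j ∈ K, edgeVal S f z (e j) = p j)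

lemma matchProb_congr {e e' : κ → Sym2 (Fin 3 × G)} {K : Finset κ} (h : ∀ j ∈ K, e j = e' j)
    (p : κ → Bool) : matchProb S f e K p = matchProb S f e' K p :=
  congrArg _ <| funext fun _ => ind_congr <| forall₂_congr fun j hj => by rw [h j hj]

lemma matchProb_twist (a b : G) (e : κ → Sym2 (Fin 3 × G)) (K : Finset κ) (p : κ → Bool) :
    matchProb S f (fun j => (e j).map fun x => (x.1, twist a b x.1 x.2)) K p =
      matchProb S f e K p := by
  rw [matchProb, ← S.mean_act a b⁻¹ _ (.ind _)]
  simp only [edgeVal_twist, matchProb]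

lemma abs_matchProb_le_one (e : κ → Sym2 (Fin 3 × G)) (K : Finset κ) (p : κ → Bool) :
    |matchProb S f e K p| ≤ 1 :=
  Mean.abs_le _ fun _ => by rw [abs_of_nonneg (ind_nonneg _)]; exact ind_le_one _

end EdgeValues

/-- The vertices of the tripartite graph on an array: pairs of a class and a time, with one further
vertex in each class, the root. -/
abbrev Vertex (T : Type*) := Fin 3 × Option T

section Labels

variable {X T : Type*}

/-- The labelling of the vertices that gives the roots the labels `w` and the other vertices the
entries of the array `v`. -/
def label (w : Fin 3 → X) (v : T → Fin 3 → X) (x : Vertex T) : Fin 3 × X :=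
  (x.1, x.2.elim (w x.1) fun t => v t x.1)

lemma map_label_congr {w w' : Fin 3 → X} {v v' : T → Fin 3 → X} {e : Sym2 (Vertex T)}
    (hw : ∀ i, (i, none) ∈ e → w i = w' i) (hv : ∀ i t, (i, some t) ∈ e → v t = v' t) :
    e.map (label w v) = e.map (label w' v') := by
  refine Sym2.map_congr ?_
  rintro ⟨i, _ | t⟩ hx
  · exact Prod.ext rfl (hw i hx)
  · exact Prod.ext rfl (congrFun (hv i t hx) i)

/-- Replacing the roots by the vertices of given times. -/
def putRoots (s : Fin 3 → T) (x : Vertex T) : Vertex T := (x.1, some (x.2.getD (s x.1)))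

lemma label_comp_putRoots (s : Fin 3 → T) (w : Fin 3 → X) (v : T → Fin 3 → X) :
    label w v ∘ putRoots s = label (fun i => v (s i) i) v := by
  ext1 ⟨i, _ | t⟩ <;> rfl

/-- Renaming the times of vertices, fixing the roots. -/
def renameTimes (r : T → T) : Vertex T → Vertex T := Prod.map id (Option.map r)

lemma label_comp_renameTimes (r : T → T) (w : Fin 3 → X) (v : T → Fin 3 → X) :
    label w v ∘ renameTimes r = label w (v ∘ r) := by
  ext1 ⟨i, _ | t⟩ <;> rfl

lemma map_map_label (θ : Fin 3 → X → X) (w : Fin 3 → X) (v : T → Fin 3 → X)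
    (e : Sym2 (Vertex T)) : (e.map (label w v)).map (fun x => (x.1, θ x.1 x.2)) =
      e.map (label (fun i => θ i (w i)) fun t i => θ i (v t i)) := by
  rw [Sym2.map_map]
  congr 1
  ext1 ⟨i, _ | t⟩ <;> rfl

end Labels

section PatternProb

variable {T : Type*} [LinearOrder T] (I : Mean G) (S : BiSystem G Z) (f : Z → Bool)

/-- The probability that finitely many edges have prescribed values, for the root labels `w` and a
random array of labels. -/
noncomputable def patternProb (w : Fin 3 → G) (e : κ → Sym2 (Vertex T)) (K : Finset κ)
    (p : κ → Bool) : ℝ :=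
  arrayMean (tupleMean I 3) 1 fun v => matchProb S f (fun j => (e j).map (label w v)) K p

/-- The times of the vertices of finitely many edges. -/
def timesOf (e : κ → Sym2 (Vertex T)) (K : Finset κ) : Finset T :=
  K.biUnion fun j => (e j).toFinset.biUnion fun x => x.2.toFinset

lemma mem_timesOf {e : κ → Sym2 (Vertex T)} {K : Finset κ} {t : T} :
    t ∈ timesOf e K ↔ ∃ j ∈ K, ∃ i, (i, some t) ∈ e j := by
  simp [timesOf]

variable {e : κ → Sym2 (Vertex T)} {K : Finset κ}

lemma dependsOn_matchProb_label (w : Fin 3 → G) (p : κ → Bool) :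
    DependsOn (fun v => matchProb S f (fun j => (e j).map (label w v)) K p)
      (timesOf e K : Set T) := fun _ _ h =>
  matchProb_congr S f (fun j hj => map_label_congr (fun _ _ => rfl) fun i t ht =>
    h t (mem_timesOf.2 ⟨j, hj, i, ht⟩)) p

lemma bddFun_patternProb {X : Type*} (w : X → Fin 3 → G) (p : κ → Bool) :
    BddFun fun x => patternProb I S f (w x) e K p :=
  Mean.bddFun (m := fun _ => arrayMean (tupleMean I 3) 1)
    ⟨1, fun _ _ => abs_matchProb_le_one S f _ K p⟩

lemma patternProb_renameTimes {r : T → T} (hr : StrictMono r) (w : Fin 3 → G) (p : κ → Bool) :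
    patternProb I S f w (fun j => (e j).map (renameTimes r)) K p = patternProb I S f w e K p := by
  simp only [patternProb, Sym2.map_map, label_comp_renameTimes]
  exact arrayMean_comp (dependsOn_matchProb_label S f w p) hr

variable {I}

lemma patternProb_twist (hI : I.IsInvariant) (a b : G) (w : Fin 3 → G) (p : κ → Bool) :
    patternProb I S f (fun i => twist a b i (w i)) e K p = patternProb I S f w e K p := by
  have h := arrayMean_map (m := tupleMean I 3) (x₀ := 1) (dependsOn_matchProb_label S f (e := e)
    (K := K) (fun i => twist a b i (w i)) p) ⟨1, fun v => abs_matchProb_le_one S f _ K p⟩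
    (θ := fun u i => twist a b i (u i)) fun g hg =>
      tupleMean_map I (θ := twist a b) (fun i F hF => hI.mul_mul _ _ hF) hg
  rw [patternProb, ← h]
  refine congrArg (arrayMean (tupleMean I 3) 1).toFun (funext fun v => ?_)
  simp only [← matchProb_twist S f a b fun j => (e j).map (label w v), map_map_label]
  rfl

lemma patternProb_normalize (hI : I.IsInvariant) (w : Fin 3 → G) (p : κ → Bool) :
    patternProb I S f w e K p = patternProb I S f ![1, 1, w 1 * w 2 * (w 0)⁻¹] e K p := by
  rw [← patternProb_twist S f hI (w 0) (w 1)]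
  refine congrArg (patternProb I S f · e K p) (funext fun i => ?_)
  fin_cases i <;> simp [twist]

lemma patternProb_congr {w w' : Fin 3 → G} (h : ∀ j ∈ K, ∀ i, (i, none) ∈ e j → w i = w' i)
    (p : κ → Bool) : patternProb I S f w e K p = patternProb I S f w' e K p :=
  congrArg (arrayMean (tupleMean I 3) 1).toFun <| funext fun _ =>
    matchProb_congr S f (fun j hj => map_label_congr (h j hj) fun _ _ _ => rfl) p

lemma patternProb_eq_one (hI : I.IsInvariant) {i : Fin 3} (h : ∀ j ∈ K, (i, none) ∉ e j) (g : G)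
    (p : κ → Bool) : patternProb I S f ![1, 1, g] e K p = patternProb I S f 1 e K p := by
  obtain ⟨x, hx⟩ : ∃ x, (update ![1, 1, g] i x : Fin 3 → G) 1 * update ![1, 1, g] i x 2 *
      (update ![1, 1, g] i x 0)⁻¹ = 1 := by
    fin_cases i
    exacts [⟨g, by simp⟩, ⟨g⁻¹, by simp⟩, ⟨1, by simp⟩]
  rw [patternProb_congr S f (w' := update ![1, 1, g] i x), patternProb_normalize S f hI, hx,
    patternProb_normalize S f hI 1]
  · simp
  · intro j hj k hk
    rw [update_of_ne]
    rintro rfl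
    exact h j hj hk

section Front

variable {t : Fin 3 → T} (ht : StrictMono t) (hK : ∀ i, ∀ s ∈ timesOf e K, t i < s)

include ht hK

lemma patternProb_putRoots_eq_tupleMean (σ : Equiv.Perm (Fin 3)) (p : κ → Bool) :
    patternProb I S f 1 (fun j => (e j).map (putRoots (t ∘ σ))) K p =
      tupleMean I 3 fun u => patternProb I S f (u ∘ σ) e K p := by
  simp only [patternProb, Sym2.map_map, label_comp_putRoots]
  refine (arrayMean_comp_front_eq (H := fun (w : Fin 3 → Fin 3 → G) v => matchProb S f
    (fun j => (e j).map (label (fun i => w (σ i) i) v)) K p)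
    (fun w => dependsOn_matchProb_label S f _ p) ht hK).trans ?_
  refine Eq.trans ?_ <| tupleMean_map (tupleMean I 3) (θ := fun i x => x (σ.symm i))
    (fun i F _ => tupleMean_apply I _ F)
    (bddFun_patternProb I S f (e := e) (K := K) (fun u => u ∘ σ) p)
  simp only [comp_def, Equiv.symm_apply_apply]

lemma patternProb_putRoots (hI : I.IsInvariant) {σ : Equiv.Perm (Fin 3)} (hσ : σ 0 = 0)
    (p : κ → Bool) : patternProb I S f 1 (fun j => (e j).map (putRoots (t ∘ σ))) K p =
      I fun g => patternProb I S f ![1, 1, g] e K p := by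
  rw [patternProb_putRoots_eq_tupleMean S f ht hK]
  simp only [patternProb_normalize S f hI (_ ∘ σ) p, comp_apply]
  have hb := bddFun_patternProb I S f (e := e) (K := K) (fun g => ![1, 1, g]) p
  obtain rfl | rfl : σ = 1 ∨ σ = Equiv.swap 1 2 := by
    revert hσ; decide +revert
  · have hc : ∀ a b, I (fun c => patternProb I S f ![1, 1, b * c * a⁻¹] e K p) =
        I fun g => patternProb I S f ![1, 1, g] e K p := fun a b => hI.mul_mul b a⁻¹ hb
    change I (fun a => I fun b => I fun c => patternProb I S f ![1, 1, b * c * a⁻¹] e K p) = _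
    simp only [hc, Mean.const]
  · have hb' : ∀ a c, I (fun b => patternProb I S f ![1, 1, b * c * a⁻¹] e K p) =
        I fun g => patternProb I S f ![1, 1, g] e K p := fun a c => by
      simpa only [mul_assoc] using hI.mul_right (c * a⁻¹) hb
    change I (fun a => I fun c => I fun b => patternProb I S f ![1, 1, b * c * a⁻¹] e K p) = _
    simp only [hb', Mean.const]

end Front

end PatternProb

end BiSystem

section BooleanProcess

open MeasureTheory

section Representation

variable {ι κ X : Type*}

lemma isClopen_cylinder (e : κ → ι) (K : Finset κ) (p : κ → Bool) :
    IsClopen {ω : ι → Bool | ∀ j ∈ K, ω (e j) = p j} := by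
  simp only [Set.ofPred_forall]
  exact K.finite_toSet.isClopen_biInter fun j _ =>
    (isClopen_discrete {p j}).preimage (continuous_apply (e j))

lemma continuous_ind {E : Type*} [TopologicalSpace E] {p : E → Prop} (hp : IsClopen {x | p x}) :
    Continuous fun x => ind (p x) := by
  have : (fun x => ind (p x)) = {x | p x}.indicator 1 := by
    ext x
    by_cases h : p x <;> simp [h]
  rw [this]
  exact continuous_one.indicator fun a ha => by simp [hp.frontier_eq] at ha

lemma integral_ind {Ω : Type*} [MeasurableSpace Ω] {P : Measure Ω} {p : Ω → Prop}
    (hp : MeasurableSet {ω | p ω}) : ∫ ω, ind (p ω) ∂P = P.real {ω | p ω} := by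
  rw [← integral_indicator_one hp]
  congr 1

lemma integral_ind_cylinder [Countable ι] (P : Measure (ι → Bool)) (e : κ → ι) (K : Finset κ)
    (p : κ → Bool) :
    ∫ ω, ind (∀ j ∈ K, ω (e j) = p j) ∂P = P.real {ω | ∀ j ∈ K, ω (e j) = p j} :=
  integral_ind (isClopen_cylinder e K p).1.measurableSet

lemma BddFun.of_continuous {E : Type*} [TopologicalSpace E] [CompactSpace E] {g : E → ℝ}
    (hg : Continuous g) : BddFun g := by
  obtain ⟨C, hC⟩ := (isCompact_range hg).isBounded.exists_norm_le
  exact ⟨C, fun x => hC _ ⟨x, rfl⟩⟩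

/-- The positive linear functional of a mean on a compact space. -/
def Mean.toPositiveLinearMap {E : Type*} [TopologicalSpace E] [CompactSpace E] (M : Mean E) :
    CompactlySupportedContinuousMap E ℝ →ₚ[ℝ] ℝ where
  toFun g := M g
  map_add' g g' := M.add (.of_continuous g.continuous) (.of_continuous g'.continuous)
  map_smul' c g := M.const_mul c (.of_continuous g.continuous)
  monotone' g g' h := M.mono (.of_continuous g.continuous) (.of_continuous g'.continuous) h

lemma Mean.exists_integral_eq {E : Type*} [TopologicalSpace E] [CompactSpace E] [T2Space E]
    [MeasurableSpace E] [BorelSpace E] (M : Mean E) :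
    ∃ P : Measure E, IsProbabilityMeasure P ∧ ∀ g : E → ℝ, Continuous g → ∫ x, g x ∂P = M g := by
  have integral_eq : ∀ g : E → ℝ, Continuous g →
      ∫ x, g x ∂(RealRMK.rieszMeasure M.toPositiveLinearMap) = M g := fun g hg =>
    RealRMK.integral_rieszMeasure M.toPositiveLinearMap
      ⟨⟨g, hg⟩, HasCompactSupport.of_compactSpace _⟩
  refine ⟨_, ⟨?_⟩, integral_eq⟩
  have h := integral_eq (fun _ => 1) continuous_const
  rwa [integral_const, smul_eq_mul, mul_one, M.const, measureReal_def,
    ENNReal.toReal_eq_one_iff] at h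

lemma Mean.exists_measure_cylinder_eq [Countable ι] (M : Mean (ι → Bool)) :
    ∃ P : Measure (ι → Bool), IsProbabilityMeasure P ∧
      ∀ {κ : Type} (e : κ → ι) (K : Finset κ) (p : κ → Bool),
        P.real {ω | ∀ j ∈ K, ω (e j) = p j} = M fun ω => ind (∀ j ∈ K, ω (e j) = p j) := by
  obtain ⟨P, hP, h⟩ := M.exists_integral_eq
  exact ⟨P, hP, fun e K p => by
    rw [← integral_ind_cylinder, h _ (continuous_ind (isClopen_cylinder e K p))]⟩

end Representation

section CylinderEvents

variable {ι κ : Type*}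

lemma map_eq_of_forall_finset {Ω : Type*} [MeasurableSpace Ω] {P Q : Measure Ω}
    [IsFiniteMeasure P] [IsFiniteMeasure Q] {U V : Ω → κ → Bool} (hU : Measurable U)
    (hV : Measurable V) (h : ∀ (J : Finset κ) (p : κ → Bool),
      P.real {ω | ∀ j ∈ J, U ω j = p j} = Q.real {ω | ∀ j ∈ J, V ω j = p j}) :
    P.map U = Q.map V := by
  have (J : Finset κ) : IsFiniteMeasure ((P.map U).map J.restrict) :=
    have := Measure.isFiniteMeasure_map P U
    Measure.isFiniteMeasure_map _ _
  refine IsProjectiveLimit.unique (P := fun J : Finset κ => (P.map U).map J.restrict)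
    (fun J => rfl) fun J => ?_
  have hr : Measurable (J.restrict (π := fun _ : κ => Bool)) := Finset.measurable_restrict J
  dsimp only
  rw [Measure.map_map hr hV, Measure.map_map hr hU]
  refine Measure.ext_of_singleton fun p => ?_
  obtain ⟨q, rfl⟩ : ∃ q : κ → Bool, J.restrict q = p := by
    classical
    exact ⟨fun j => if hj : j ∈ J then p ⟨j, hj⟩ else true, by ext j; simp⟩
  have preimage_eq (W : Ω → κ → Bool) :
      J.restrict ∘ W ⁻¹' {J.restrict q} = {ω | ∀ j ∈ J, W ω j = q j} := by
    ext ω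
    simp [funext_iff]
  rw [Measure.map_apply (hr.comp hV) (measurableSet_singleton _),
    Measure.map_apply (hr.comp hU) (measurableSet_singleton _), preimage_eq, preimage_eq]
  exact ((measureReal_eq_measureReal_iff).1 (h J q)).symm

lemma comap_pi_eq_cylinderEvents {D : Set κ} (τ : κ → ι) :
    (MeasurableSpace.pi : MeasurableSpace (D → Bool)).comap
      (fun (ω : ι → Bool) (j : D) => ω (τ j)) = cylinderEvents (τ '' D) := by
  simp only [MeasurableSpace.pi, cylinderEvents, MeasurableSpace.comap_iSup,
    MeasurableSpace.comap_comp, iSup_image, iSup_subtype]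
  rfl

lemma UnitRV.exists_eq_restrict {D : Set ι} {f : (ι → Bool) → ℝ}
    (hf : UnitRV (cylinderEvents D) f) :
    ∃ g : (D → Bool) → ℝ, Measurable g ∧ f = fun ω => g fun j => ω j := by
  have h := comap_pi_eq_cylinderEvents (D := D) (id : ι → ι)
  rw [Set.image_id] at h
  rw [← h] at hf
  obtain ⟨g, hg, rfl⟩ := hf.exists_eq_comp
  exact ⟨g, hg.meas, rfl⟩

lemma UnitRV.congr_of_cylinderEvents {D : Set ι} {f : (ι → Bool) → ℝ}
    (hf : UnitRV (cylinderEvents D) f) {ω ω' : ι → Bool} (h : ∀ j ∈ D, ω j = ω' j) :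
    f ω = f ω' := by
  obtain ⟨g, -, rfl⟩ := hf.exists_eq_restrict
  exact congrArg g (funext fun j => h j j.2)

/-- The coordinates in a set have the same joint law after two substitutions. -/
def SameLaw (P : Measure (ι → Bool)) (τ τ' : κ → ι) (D : Set κ) : Prop :=
  P.map (fun ω (j : D) => ω (τ j)) = P.map fun ω (j : D) => ω (τ' j)

lemma measurable_comp_restrict (τ : κ → ι) (D : Set κ) :
    Measurable fun (ω : ι → Bool) (j : D) => ω (τ j) :=
  measurable_pi_iff.2 fun _ => measurable_pi_apply _

namespace SameLaw

variable {P : Measure (ι → Bool)} {τ τ' : κ → ι} {K₀ : Set κ}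

lemma of_forall_finset [IsFiniteMeasure P] (h : ∀ (K : Finset K₀) (p : K₀ → Bool),
    P.real {ω | ∀ j ∈ K, ω (τ j) = p j} = P.real {ω | ∀ j ∈ K, ω (τ' j) = p j}) :
    SameLaw P τ τ' K₀ :=
  map_eq_of_forall_finset (measurable_comp_restrict τ K₀) (measurable_comp_restrict τ' K₀) h

lemma integral_eq (h : SameLaw P τ τ' K₀) {f : (κ → Bool) → ℝ}
    (hf : UnitRV (cylinderEvents K₀) f) :
    ∫ ω, f (fun j => ω (τ j)) ∂P = ∫ ω, f (fun j => ω (τ' j)) ∂P := by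
  obtain ⟨g, hg, rfl⟩ := hf.exists_eq_restrict
  rw [← integral_map (f := g) (measurable_comp_restrict τ K₀).aemeasurable
    hg.aestronglyMeasurable, show P.map _ = _ from h,
    integral_map (measurable_comp_restrict τ' K₀).aemeasurable hg.aestronglyMeasurable]

lemma map_prod_eq (h : SameLaw P τ τ' K₀) {f : (ι → Bool) → ℝ} {B : Set ι} {D : Set κ}
    (hf : UnitRV (cylinderEvents B) f) (hB : ∀ e ∈ B, ∃ j ∈ K₀, τ j = e ∧ τ' j = e)
    (hD : D ⊆ K₀) :
    P.map (fun ω => (f ω, fun j : D => ω (τ j))) = P.map fun ω => (f ω, fun j : D => ω (τ' j)) := by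
  obtain ⟨g, hg, rfl⟩ := hf.exists_eq_restrict
  have hB' : ∀ e : B, ∃ j ∈ K₀, τ j = e ∧ τ' j = e := fun e => hB e e.2
  choose s hsK hsτ hsτ' using hB'
  let Φ (η : K₀ → Bool) : ℝ × (D → Bool) := (g fun e => η ⟨s e, hsK e⟩, fun j => η ⟨j, hD j.2⟩)
  have hΦ : Measurable Φ := (hg.comp (measurable_pi_iff.2 fun _ => measurable_pi_apply _)).prodMk
    (measurable_pi_iff.2 fun _ => measurable_pi_apply _)
  have key := congrArg (Measure.map Φ) h
  rw [Measure.map_map hΦ (measurable_comp_restrict τ K₀),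
    Measure.map_map hΦ (measurable_comp_restrict τ' K₀)] at key
  simpa only [comp_def, Φ, hsτ, hsτ'] using key

lemma condE_eq [IsProbabilityMeasure P] (h : SameLaw P τ τ' K₀) {f : (ι → Bool) → ℝ}
    {B D₁ D₂ : Set ι} {D : Set κ} (hf : UnitRV (cylinderEvents B) f)
    (hB : ∀ e ∈ B, ∃ j ∈ K₀, τ j = e ∧ τ' j = e) (hD : D ⊆ K₀) (h1 : Set.MapsTo τ' D D₁)
    (h2 : τ '' D = D₂) (h12 : D₁ ⊆ D₂) :
    condE P (cylinderEvents D₂) f =ᵐ[P] condE P (cylinderEvents D₁) f := by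
  subst h2
  rw [← comap_pi_eq_cylinderEvents (D := D) τ]
  refine condE_comap_eq_of_map_eq (hf.mono cylinderEvents_le_pi) (measurable_comp_restrict τ D)
    (measurable_comp_restrict τ' D) (h.map_prod_eq hf hB hD) ?_ ?_
  · rw [comap_pi_eq_cylinderEvents]
    exact cylinderEvents_mono h1.image_subset
  · rw [comap_pi_eq_cylinderEvents]
    exact cylinderEvents_mono h12

end SameLaw

end CylinderEvents

section Edges

section Sym2

variable {V V' : Type*} {r : V → V'} {U U' : Set V} {W : Set V'}

lemma sym2_mono (h : U ⊆ U') : U.sym2 ⊆ U'.sym2 := fun _ => by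
  simp only [Set.mem_sym2_iff_subset]
  exact fun hz => hz.trans h

lemma mapsTo_sym2_map (h : Set.MapsTo r U W) : Set.MapsTo (Sym2.map r) U.sym2 W.sym2 :=
  Set.mapsTo_iff_image_subset.2 (Set.sym2_image ▸ sym2_mono h.image_subset)

lemma injOn_sym2_map (h : Set.InjOn r U) : Set.InjOn (Sym2.map r) U.sym2 :=
  Sym2.ind fun x y hxy => Sym2.ind fun x' y' hxy' heq => by
    rw [Sym2.map_mk, Sym2.map_mk, Sym2.eq_iff] at heq
    rw [Sym2.eq_iff, ← h.eq_iff hxy.1 hxy'.1, ← h.eq_iff hxy.2 hxy'.2, ← h.eq_iff hxy.1 hxy'.2,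
      ← h.eq_iff hxy.2 hxy'.1]
    exact heq

end Sym2

variable {V V' : Type*} {P : Measure (Sym2 V → Bool)} [IsProbabilityMeasure P] {r r' : V' → V}
  {V₀ U : Set V'} {W U₁ U₂ : Set V} {f : (Sym2 V → Bool) → ℝ}

namespace SameLaw

lemma condE_sym2 (h : SameLaw P (Sym2.map r) (Sym2.map r') V₀.sym2)
    (hf : UnitRV (cylinderEvents W.sym2) f) (hW : ∀ x ∈ W, ∃ y ∈ V₀, r y = x ∧ r' y = x)
    (hU : U ⊆ V₀) (h1 : Set.MapsTo r' U U₁) (h2 : r '' U = U₂) (h12 : U₁ ⊆ U₂) :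
    condE P (cylinderEvents U₂.sym2) f =ᵐ[P] condE P (cylinderEvents U₁.sym2) f := by
  refine h.condE_eq hf ?_ (sym2_mono hU) (mapsTo_sym2_map h1) ?_ (sym2_mono h12)
  · refine Sym2.ind fun x y hxy => ?_
    obtain ⟨x', hx', rfl, hx⟩ := hW x hxy.1
    obtain ⟨y', hy', rfl, hy⟩ := hW y hxy.2
    exact ⟨s(x', y'), ⟨hx', hy'⟩, rfl, by rw [Sym2.map_mk, hx, hy]⟩
  · rw [← Set.sym2_image, h2]

lemma condE_sym2_sdiff (h : SameLaw P (Sym2.map r) (Sym2.map r') V₀.sym2) {a b : V'}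
    (hf : UnitRV (cylinderEvents {s(r a, r b)}) f) (ha : r' a = r a) (hb : r' b = r b)
    (hr : Set.InjOn r U) (hr' : Set.InjOn r' U) (haU : a ∈ U) (hbU : b ∈ U)
    (hU : U ⊆ V₀) (h1 : Set.MapsTo r' U U₁) (h2 : r '' U = U₂) (h12 : U₁ ⊆ U₂) :
    condE P (cylinderEvents (U₂.sym2 \ {s(r a, r b)})) f =ᵐ[P]
      condE P (cylinderEvents (U₁.sym2 \ {s(r a, r b)})) f := by
  have hab : s(a, b) ∈ U.sym2 := ⟨haU, hbU⟩
  refine h.condE_eq (D := U.sym2 \ {s(a, b)}) hf ?_ (Set.sdiff_subset.trans (sym2_mono hU)) ?_ ?_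
    (Set.sdiff_subset_sdiff_left (sym2_mono h12))
  · rintro _ rfl
    exact ⟨s(a, b), sym2_mono hU hab, rfl, by rw [Sym2.map_mk, ha, hb]⟩
  · rintro j ⟨hj, hne⟩
    refine ⟨mapsTo_sym2_map h1 hj, fun h => hne ?_⟩
    rw [Set.mem_singleton_iff, ← ha, ← hb] at h
    exact injOn_sym2_map hr' hj hab h
  · rw [(injOn_sym2_map hr).image_sdiff_subset (Set.singleton_subset_iff.2 hab),
      ← Set.sym2_image, h2, Set.image_singleton, Sym2.map_mk]

end SameLaw

end Edges

end BooleanProcess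

section Times

/-- The times of the array. -/
abbrev Time := ℕ ×ₗ ℕ

instance : Countable Time := inferInstanceAs (Countable (ℕ × ℕ))

/-- The times `(0, n)`, which precede the times of all other rows. -/
def frontTime (n : ℕ) : Time := toLex (0, n)

lemma strictMono_frontTime : StrictMono frontTime := fun _ _ h =>
  Prod.Lex.toLex_lt_toLex.2 (.inr ⟨rfl, h⟩)

/-- The vertices of the times from `s` on. -/
def late (s : Time) : Set (Vertex Time) := {x | ∃ t, x.2 = some t ∧ s ≤ t}

lemma late_anti {s t : Time} (h : s ≤ t) : late t ⊆ late s := fun _ ⟨u, hu, htu⟩ =>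
  ⟨u, hu, h.trans htu⟩

/-- The vertices of the times outside the front row. -/
def sample : Set (Vertex Time) := late (toLex (1, 0))

lemma sample_subset_late (n : ℕ) : sample ⊆ late (frontTime n) :=
  late_anti (Prod.Lex.toLex_le_toLex.2 (.inl one_pos))

/-- The vertex without a time of a class. -/
def root (i : Fin 3) : Vertex Time := (i, none)

lemma root_notMem_late (i : Fin 3) (s : Time) : root i ∉ late s := by
  rintro ⟨t, ht, -⟩
  cases ht

/-- The times of the vertices that take the places of the roots. -/
def apexTime (i : Fin 3) : Time := frontTime i

lemma strictMono_apexTime : StrictMono apexTime := fun _ _ h => strictMono_frontTime h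

/-- The vertex that takes the place of the root of a class. -/
def apex (i : Fin 3) : Vertex Time := (i, some (apexTime i))

lemma putRoots_of_mem_late (s : Fin 3 → Time) {t : Time} {x : Vertex Time} (hx : x ∈ late t) :
    putRoots s x = x := by
  obtain ⟨u, hu, -⟩ := hx
  exact Prod.ext rfl (by simp [putRoots, hu])

lemma apex_notMem_late {i : Fin 3} {s : Time} (h : apexTime i < s) : apex i ∉ late s := by
  rintro ⟨t, ht, hst⟩
  rw [← Option.some.inj ht] at hst
  exact hst.not_gt h

lemma mapsTo_renameTimes_late {r : Time → Time} (hr : StrictMono r) (s : Time) :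
    Set.MapsTo (renameTimes r) (late s) (late (r s)) := by
  rintro x ⟨t, ht, hst⟩
  exact ⟨r t, by simp [renameTimes, ht], hr.monotone hst⟩

lemma renameTimes_injective {r : Time → Time} (hr : StrictMono r) : Injective (renameTimes r) :=
  injective_id.prodMap (Option.map_injective hr.injective)

/-- Moving the front times from `(0, n)` on by `d`. -/
def gap (n d : ℕ) (t : Time) : Time :=
  if (ofLex t).1 = 0 ∧ n ≤ (ofLex t).2 then toLex (0, (ofLex t).2 + d) else t

lemma strictMono_gap (n d : ℕ) : StrictMono (gap n d) := by
  intro s t h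
  unfold gap
  split_ifs <;> simp only [Prod.Lex.lt_iff, ofLex_toLex] at * <;> lia

lemma gap_of_lt {n d : ℕ} {t : Time} (h : t < frontTime n) : gap n d t = t := by
  refine if_neg fun ht => ?_
  rw [Prod.Lex.lt_iff] at h
  simp only [frontTime, ofLex_toLex] at h
  omega

lemma gap_frontTime {n d k : ℕ} (h : n ≤ k) : gap n d (frontTime k) = frontTime (k + d) :=
  if_pos ⟨rfl, h⟩

lemma renameTimes_gap_of_mem_sample (n d : ℕ) {x : Vertex Time} (hx : x ∈ sample) :
    renameTimes (gap n d) x = x := by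
  obtain ⟨t, ht, h⟩ := hx
  have : gap n d t = t := if_neg fun h0 => by
    rw [Prod.Lex.le_iff] at h
    simp only [ofLex_toLex] at h
    omega
  exact Prod.ext rfl (by simp [renameTimes, ht, this])

/-- Moving the times from `(0, n)` on to the following rows. -/
def drop (n : ℕ) (t : Time) : Time :=
  if t < frontTime n then t else toLex ((ofLex t).1 + 1, (ofLex t).2)

lemma strictMono_drop (n : ℕ) : StrictMono (drop n) := by
  intro s t h
  unfold drop
  split_ifs <;>
    simp only [frontTime, Prod.Lex.lt_iff, ofLex_toLex] at * <;> omega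

lemma drop_of_lt {n : ℕ} {t : Time} (h : t < frontTime n) : drop n t = t := if_pos h

lemma mapsTo_drop_late {n : ℕ} : Set.MapsTo (renameTimes (drop n)) (late (frontTime n)) sample := by
  refine (mapsTo_renameTimes_late (strictMono_drop n) _).mono_right (late_anti ?_)
  rw [drop, if_neg (lt_irrefl _)]
  exact Prod.Lex.toLex_le_toLex.2 (.inr ⟨rfl, n.zero_le⟩)

/-- The roots and the vertices of the times after those that take the places of the roots. -/
def patternVertices : Set (Vertex Time) := Set.range root ∪ late (frontTime 3)

lemma apexTime_lt (i : Fin 3) : apexTime i < frontTime 3 := strictMono_frontTime i.2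

lemma apexTime_lt_of_mem_timesOf {κ : Type*} {e : κ → Sym2 (Vertex Time)} {K : Finset κ}
    (hK : ∀ j ∈ K, e j ∈ patternVertices.sym2) (i : Fin 3) {t : Time} (ht : t ∈ timesOf e K) :
    apexTime i < t := by
  obtain ⟨j, hj, k, hk⟩ := mem_timesOf.1 ht
  obtain ⟨l, h⟩ | ⟨s, hs, h⟩ := Set.mem_sym2_iff_subset.1 (hK j hj) hk
  · cases h
  · exact (apexTime_lt i).trans_le (Option.some.inj hs ▸ h)

end Times

section ArrayMeasure

open MeasureTheory

variable {G Z : Type*} [Group G] {I : Mean G} {S : BiSystem G Z} {f : Z → Bool}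

variable (I S f) in
/-- The measure represents the mean of the edge values of the random array of labels, with the
labels `1` at the roots. -/
def IsArrayMeasure (P : Measure (Sym2 (Vertex Time) → Bool)) : Prop :=
  ∀ {κ : Type} (e : κ → Sym2 (Vertex Time)) (K : Finset κ) (p : κ → Bool),
    P.real {ω | ∀ j ∈ K, ω (e j) = p j} = patternProb I S f 1 e K p

variable (I S f) in
lemma exists_isArrayMeasure :
    ∃ P : Measure (Sym2 (Vertex Time) → Bool), IsProbabilityMeasure P ∧ IsArrayMeasure I S f P :=
  have ⟨P, hP, h⟩ := ((arrayMean (tupleMean I 3) 1).bind fun v => S.mean.map fun z e =>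
    edgeVal S f z (Sym2.map (label 1 v) e)).exists_measure_cylinder_eq
  ⟨P, hP, fun e K p => h e K p⟩

namespace IsArrayMeasure

variable {P : Measure (Sym2 (Vertex Time) → Bool)} (hP : IsArrayMeasure I S f P)

include hP

lemma sameLaw_renameTimes [IsFiniteMeasure P] {r : Time → Time} (hr : StrictMono r)
    (U : Set (Vertex Time)) : SameLaw P (Sym2.map id) (Sym2.map (renameTimes r)) U.sym2 :=
  .of_forall_finset fun K p => by
    rw [hP, hP, patternProb_renameTimes I S f (e := fun j : U.sym2 => j.1) hr]
    rw [Sym2.map_id]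
    rfl

lemma real_putRoots (hI : I.IsInvariant) {σ : Equiv.Perm (Fin 3)} (hσ : σ 0 = 0) {κ : Type}
    {e : κ → Sym2 (Vertex Time)} {K : Finset κ} (hK : ∀ j ∈ K, e j ∈ patternVertices.sym2)
    (p : κ → Bool) :
    P.real {ω | ∀ j ∈ K, ω ((e j).map (putRoots (apexTime ∘ σ))) = p j} =
      I fun g => patternProb I S f ![1, 1, g] e K p := by
  rw [hP, patternProb_putRoots S f strictMono_apexTime
    (fun i _ => apexTime_lt_of_mem_timesOf hK i) hI hσ]

/-- The last two roots can be exchanged since the label of the third one is determined by those of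
the first two up to a translation. -/
lemma sameLaw_swap [IsFiniteMeasure P] (hI : I.IsInvariant) {r : Time → Time} (hr : StrictMono r) :
    SameLaw P (Sym2.map (putRoots apexTime))
      (Sym2.map (renameTimes r ∘ putRoots (apexTime ∘ Equiv.swap 1 2))) patternVertices.sym2 :=
  .of_forall_finset fun K p => by
    have h1 := hP.real_putRoots hI (σ := 1) rfl (fun j _ => j.2) p (K := K)
    have h2 := hP.real_putRoots hI (σ := Equiv.swap 1 2) (by decide) (fun j _ => j.2) p (K := K)
    rw [hP, ← patternProb_renameTimes I S f hr, ← hP] at h2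
    simp only [Sym2.map_map] at h2
    exact h1.trans h2.symm

lemma sameLaw_putRoots [IsFiniteMeasure P] (hI : I.IsInvariant) {U : Set (Vertex Time)}
    (hU : U ⊆ patternVertices) {i : Fin 3} (hi : root i ∉ U) :
    SameLaw P (Sym2.map (putRoots apexTime)) id U.sym2 :=
  .of_forall_finset fun K p => by
    have h := hP.real_putRoots hI (σ := 1) rfl (fun j _ => sym2_mono hU j.2) p (K := K)
    simp only [patternProb_eq_one S f hI fun (j : U.sym2) _ hj =>
      hi (Set.mem_sym2_iff_subset.1 j.2 hj), Mean.const] at h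
    exact h.trans (hP _ K p).symm

end IsArrayMeasure

end ArrayMeasure

section Transport

open MeasureTheory

variable {G Z : Type*} [Group G] {I : Mean G} {S : BiSystem G Z} {f : Z → Bool}
  {P : Measure (Sym2 (Vertex Time) → Bool)} [IsProbabilityMeasure P]
  (hP : IsArrayMeasure I S f P) {W : Set (Vertex Time)}
  {Y Y' : (Sym2 (Vertex Time) → Bool) → ℝ}

/-- The `σ`-algebra of the edges between the vertices of the times after the apexes. -/
abbrev lateEvents : MeasurableSpace (Sym2 (Vertex Time) → Bool) :=
  cylinderEvents (late (frontTime 3)).sym2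

/-- The two apexes of given classes and the vertices of the sample. -/
def seen (i j : Fin 3) : Set (Vertex Time) := {apex i, apex j} ∪ sample

lemma left_mem_seen (i j : Fin 3) : apex i ∈ seen i j := .inl (.inl rfl)

lemma right_mem_seen (i j : Fin 3) : apex j ∈ seen i j := .inl (.inr rfl)

lemma sample_subset_seen (i j : Fin 3) : sample ⊆ seen i j := Set.subset_union_right

/-- The `σ`-algebra of the edges seen by a pair of apexes, without the edge that joins them. -/
abbrev seenEvents (i j : Fin 3) : MeasurableSpace (Sym2 (Vertex Time) → Bool) :=
  cylinderEvents ((seen i j).sym2 \ {s(apex i, apex j)})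

lemma apexTime_lt_frontTime {i : Fin 3} {n : ℕ} (h : i < n) : apexTime i < frontTime n :=
  strictMono_frontTime h

lemma apex_mem_late {i : Fin 3} {n : ℕ} (h : n ≤ i) : apex i ∈ late (frontTime n) :=
  ⟨_, rfl, strictMono_frontTime.monotone h⟩

lemma apex_notMem_sample (i : Fin 3) : apex i ∉ sample :=
  apex_notMem_late (Prod.Lex.toLex_lt_toLex.2 (.inl one_pos))

lemma renameTimes_apex {r : Time → Time} {i : Fin 3} (h : r (apexTime i) = apexTime i) :
    renameTimes r (apex i) = apex i :=
  Prod.ext rfl (congrArg some h)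

namespace IsArrayMeasure

include hP

lemma condE_late_ae_eq {n : ℕ} (hn : n ≤ 3)
    (hW : W ⊆ apex '' {i | (i : ℕ) < n} ∪ sample) (hY : UnitRV (cylinderEvents W.sym2) Y) :
    condE P (cylinderEvents (late (frontTime n)).sym2) Y =ᵐ[P] condE P lateEvents Y := by
  refine (hP.sameLaw_renameTimes (strictMono_gap n (3 - n)) Set.univ).condE_sym2 hY ?_
    (Set.subset_univ (late (frontTime n))) ?_ (Set.image_id _)
    (late_anti (strictMono_frontTime.monotone hn))
  · refine fun x hx => ⟨x, trivial, rfl, ?_⟩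
    obtain ⟨i, hi, rfl⟩ | hx := hW hx
    · exact renameTimes_apex (gap_of_lt (apexTime_lt_frontTime hi))
    · exact renameTimes_gap_of_mem_sample _ _ hx
  · have h := mapsTo_renameTimes_late (strictMono_gap n (3 - n)) (frontTime n)
    rwa [gap_frontTime le_rfl, Nat.add_sub_cancel' hn] at h

lemma condUncorrelated_of_late {n : ℕ} (hn : n ≤ 3)
    (hW : W ⊆ apex '' {i | (i : ℕ) < n} ∪ sample) (hY : UnitRV (cylinderEvents W.sym2) Y)
    (hY' : UnitRV (cylinderEvents (late (frontTime n)).sym2) Y') :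
    CondUncorrelated P lateEvents Y Y' :=
  condUncorrelated_of_condE_eq
    (cylinderEvents_mono (sym2_mono (late_anti (strictMono_frontTime.monotone hn))))
    cylinderEvents_le_pi (hY.mono cylinderEvents_le_pi) hY' (hP.condE_late_ae_eq hn hW hY)

lemma condE_insert_late_ae_eq (hI : I.IsInvariant)
    (hY : UnitRV (cylinderEvents (seen 0 2).sym2) Y) :
    condE P (cylinderEvents (insert (apex 1) (late (frontTime 3))).sym2) Y =ᵐ[P]
      condE P lateEvents Y := by
  have hlate : ∀ x ∈ late (frontTime 3), putRoots (apexTime ∘ Equiv.swap 1 2) x = x :=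
    fun x => putRoots_of_mem_late _
  have hU : insert (root 1) (late (frontTime 3)) ⊆ patternVertices :=
    Set.insert_subset (.inl ⟨1, rfl⟩) Set.subset_union_right
  refine (hP.sameLaw_swap hI (strictMono_gap 1 1)).condE_sym2 hY ?_ hU ?_ ?_
    (Set.subset_insert _ _)
  · rintro x ((rfl | rfl) | hx)
    · exact ⟨root 0, .inl ⟨0, rfl⟩, rfl, rfl⟩
    · exact ⟨root 2, .inl ⟨2, rfl⟩, rfl, rfl⟩
    · have hx3 := sample_subset_late 3 hx
      refine ⟨x, .inr hx3, putRoots_of_mem_late _ hx3, ?_⟩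
      rw [comp_apply, hlate x hx3, renameTimes_gap_of_mem_sample _ _ hx]
  · rintro x (rfl | hx)
    · exact ⟨frontTime 3, rfl, le_rfl⟩
    · rw [comp_apply, hlate x hx]
      refine late_anti ?_ (mapsTo_renameTimes_late (strictMono_gap 1 1) _ hx)
      rw [gap_frontTime (by norm_num)]
      exact strictMono_frontTime.monotone (by norm_num)
  · rw [Set.image_insert_eq, Set.image_congr fun x => putRoots_of_mem_late _, Set.image_id']
    rfl

lemma condUncorrelated_of_insert_late (hI : I.IsInvariant)
    (hY : UnitRV (cylinderEvents (seen 0 2).sym2) Y)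
    (hY' : UnitRV (cylinderEvents (insert (apex 1) (late (frontTime 3))).sym2) Y') :
    CondUncorrelated P lateEvents Y Y' :=
  condUncorrelated_of_condE_eq (cylinderEvents_mono (sym2_mono (Set.subset_insert _ _)))
    cylinderEvents_le_pi (hY.mono cylinderEvents_le_pi) hY' (hP.condE_insert_late_ae_eq hI hY)

lemma condE_edge_zero_one_ae_eq (hY : UnitRV (cylinderEvents {s(apex 0, apex 1)}) Y) :
    condE P (cylinderEvents
      (({apex 0, apex 1} ∪ late (frontTime 2)).sym2 \ {s(apex 0, apex 1)})) Y =ᵐ[P]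
      condE P (seenEvents 0 1) Y := by
  have hfix : ∀ i : Fin 3, i.1 < 2 → renameTimes (drop 2) (apex i) = apex i := fun i hi =>
    renameTimes_apex (drop_of_lt (apexTime_lt_frontTime hi))
  refine (hP.sameLaw_renameTimes (strictMono_drop 2) Set.univ).condE_sym2_sdiff hY
    (hfix 0 (by decide)) (hfix 1 (by decide)) (Set.injOn_id _)
    (renameTimes_injective (strictMono_drop 2)).injOn (.inl (.inl rfl)) (.inl (.inr rfl))
    (Set.subset_univ _) ?_ (Set.image_id _)
    (Set.union_subset_union_right _ (sample_subset_late 2))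
  rintro x ((rfl | rfl) | hx)
  · exact .inl (.inl (hfix 0 (by decide)))
  · exact .inl (.inr (hfix 1 (by decide)))
  · exact .inr (mapsTo_drop_late hx)

end IsArrayMeasure

lemma injOn_putRoots (σ : Equiv.Perm (Fin 3)) :
    Set.InjOn (putRoots (apexTime ∘ σ)) patternVertices := by
  have hroot : ∀ i, ∀ x ∈ late (frontTime 3), putRoots (apexTime ∘ σ) (root i) ≠ x := by
    rintro i _ ⟨t, ht, h⟩ rfl
    exact h.not_gt (Option.some.inj ht ▸ apexTime_lt _)
  rintro _ (⟨i, rfl⟩ | hx) _ (⟨j, rfl⟩ | hy) h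
  · exact congrArg root (congrArg Prod.fst h)
  · exact absurd (h.trans (putRoots_of_mem_late _ hy)) (hroot i _ hy)
  · exact absurd (h.symm.trans (putRoots_of_mem_late _ hx)) (hroot j _ hx)
  · rwa [putRoots_of_mem_late _ hx, putRoots_of_mem_late _ hy] at h

lemma image_putRoots_patternVertices :
    putRoots apexTime '' patternVertices = Set.range apex ∪ late (frontTime 3) := by
  rw [patternVertices, Set.image_union, Set.image_congr fun x => putRoots_of_mem_late _,
    Set.image_id', ← Set.range_comp]
  rfl

include hP in
lemma IsArrayMeasure.condE_edge_zero_two_ae_eq (hI : I.IsInvariant)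
    (hY : UnitRV (cylinderEvents {s(apex 0, apex 2)}) Y) :
    condE P (cylinderEvents
      ((Set.range apex ∪ late (frontTime 3)).sym2 \ {s(apex 0, apex 2)})) Y =ᵐ[P]
      condE P (seenEvents 0 2) Y := by
  have hr : StrictMono (drop 3 ∘ gap 1 1) := (strictMono_drop 3).comp (strictMono_gap 1 1)
  refine (hP.sameLaw_swap hI hr).condE_sym2_sdiff (a := root 0) (b := root 2) hY rfl rfl
    (injOn_putRoots 1) ((renameTimes_injective hr).comp_injOn (injOn_putRoots _))
    (.inl ⟨0, rfl⟩) (.inl ⟨2, rfl⟩) subset_rfl ?_ image_putRoots_patternVertices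
    (Set.union_subset_union (by grind) (sample_subset_late 3))
  rintro _ (⟨i, rfl⟩ | hx)
  · fin_cases i
    · exact .inl (.inl rfl)
    · exact .inr ⟨_, rfl, by decide⟩
    · exact .inl (.inr rfl)
  · refine .inr ?_
    rw [comp_apply, putRoots_of_mem_late _ hx]
    refine late_anti ?_ (mapsTo_renameTimes_late hr _ hx)
    decide

end Transport

section Cells

open MeasureTheory

lemma exists_range_eq_sample : ∃ u : ℕ → Vertex Time, sample = Set.range u :=
  (Set.to_countable sample).exists_eq_range ⟨(0, some (toLex (1, 0))), _, rfl, le_rfl⟩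

/-- An enumeration of the sample. -/
noncomputable def sampleEnum : ℕ → Vertex Time := exists_range_eq_sample.choose

lemma sampleEnum_mem (k : ℕ) : sampleEnum k ∈ sample :=
  exists_range_eq_sample.choose_spec ▸ ⟨k, rfl⟩

lemma exists_sampleEnum_eq {x : Vertex Time} (hx : x ∈ sample) : ∃ k, sampleEnum k = x :=
  exists_range_eq_sample.choose_spec.subset hx

/-- The cell of a vertex, given by the values of its edges to the first `n` vertices of the sample.
The value of its loop is included since `Set.sym2` contains the loops. -/
noncomputable def cell (x : Vertex Time) (n : ℕ) (ω : Sym2 (Vertex Time) → Bool) :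
    Bool × (Fin n → Bool) :=
  (ω s(x, x), fun k => ω s(x, sampleEnum k))

/-- The cells of a pair of vertices. -/
noncomputable abbrev cellPair (x y : Vertex Time) (n : ℕ) (ω : Sym2 (Vertex Time) → Bool) :
    (Bool × (Fin n → Bool)) × (Bool × (Fin n → Bool)) :=
  (cell x n ω, cell y n ω)

variable {x y : Vertex Time} {n : ℕ} {D : Set (Sym2 (Vertex Time))} {U : Set (Vertex Time)}

lemma measurable_cell (hx : s(x, x) ∈ D) (h : ∀ z ∈ sample, s(x, z) ∈ D) :
    Measurable[cylinderEvents D] (cell x n) :=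
  (measurable_cylinderEvent_apply hx).prodMk <| @measurable_pi_lambda _ _ _ (_) _ _ fun k =>
    measurable_cylinderEvent_apply (h _ (sampleEnum_mem k))

lemma measurable_cell_sym2 (hx : x ∈ U) (h : sample ⊆ U) :
    Measurable[cylinderEvents U.sym2] (cell x n) :=
  measurable_cell ⟨hx, hx⟩ fun _ hz => ⟨hx, h hz⟩

lemma measurable_cell_pi : Measurable (cell x n) :=
  (measurable_cell_sym2 (Set.mem_univ x) (Set.subset_univ _)).mono cylinderEvents_le_pi le_rfl

lemma measurable_cellPair_comap_of_le {k : ℕ} (h : n ≤ k) :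
    Measurable[MeasurableSpace.comap (cellPair x y k) inferInstance] (cellPair x y n) := by
  have hres : Measurable fun c : (Bool × (Fin k → Bool)) × (Bool × (Fin k → Bool)) =>
      (((c.1.1, fun i => c.1.2 (Fin.castLE h i)), (c.2.1, fun i => c.2.2 (Fin.castLE h i))) :
        (Bool × (Fin n → Bool)) × (Bool × (Fin n → Bool))) := by fun_prop
  exact hres.comp (comap_measurable (cellPair x y k))

/-- The filtration that adds the growing cells of a pair of vertices to the late events. -/
noncomputable def cellFiltration (x y : Vertex Time) :
    Filtration ℕ (MeasurableSpace.pi : MeasurableSpace (Sym2 (Vertex Time) → Bool)) where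
  seq n := lateEvents ⊔ MeasurableSpace.comap (cellPair x y n) inferInstance
  mono' _ _ h := sup_le_sup_left (measurable_cellPair_comap_of_le h).comap_le _
  le' _ := sup_le cylinderEvents_le_pi (measurable_cell_pi.prodMk measurable_cell_pi).comap_le

lemma iSup_cellFiltration_le (hxy : x ≠ y) (hx : x ∉ late (frontTime 3))
    (hy : y ∉ late (frontTime 3)) (hU : {x, y} ∪ late (frontTime 3) ⊆ U) :
    ⨆ n, cellFiltration x y n ≤ cylinderEvents (U.sym2 \ {s(x, y)}) := by
  have hxU : x ∈ U := hU (.inl (.inl rfl))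
  have hyU : y ∈ U := hU (.inl (.inr rfl))
  have hs : sample ⊆ U := (sample_subset_late 3).trans (Set.subset_union_right.trans hU)
  have hl : ∀ z z', z ∈ late (frontTime 3) → s(z', z) ≠ s(x, y) := by
    rintro z z' hz h
    obtain ⟨-, rfl⟩ | ⟨-, rfl⟩ := Sym2.eq_iff.1 h
    exacts [hy hz, hx hz]
  refine iSup_le fun n => sup_le (cylinderEvents_mono ?_) (Measurable.comap_le <| .prodMk
    (measurable_cell ⟨⟨hxU, hxU⟩, ?_⟩ fun z hz => ⟨⟨hxU, hs hz⟩, hl _ _ (sample_subset_late 3 hz)⟩)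
    (measurable_cell ⟨⟨hyU, hyU⟩, ?_⟩ fun z hz => ⟨⟨hyU, hs hz⟩, hl _ _ (sample_subset_late 3 hz)⟩))
  · exact Sym2.ind fun z z' h => ⟨sym2_mono (Set.subset_union_right.trans hU) h, hl _ _ h.2⟩
  · simpa [Sym2.eq_iff] using hxy
  · simpa [Sym2.eq_iff] using hxy.symm

lemma measurable_apply_left_iSup_cellFiltration {z : Vertex Time} (hz : z = x ∨ z ∈ sample) :
    Measurable[⨆ n, cellFiltration x y n] fun ω : Sym2 (Vertex Time) → Bool => ω s(x, z) := by
  have hcell (n : ℕ) : Measurable[⨆ n, cellFiltration x y n] (cell x n) :=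
    (measurable_fst.comp (comap_measurable (cellPair x y n))).mono
      (le_sup_right.trans (le_iSup (fun n => cellFiltration x y n) n)) le_rfl
  obtain rfl | hz := hz
  · exact measurable_fst.comp (hcell 0)
  · obtain ⟨k, rfl⟩ := exists_sampleEnum_eq hz
    exact (measurable_pi_apply (Fin.last k)).comp (measurable_snd.comp (hcell (k + 1)))

lemma iSup_cellFiltration_comm : ⨆ n, cellFiltration x y n = ⨆ n, cellFiltration y x n := by
  have hle (x y : Vertex Time) : ⨆ n, cellFiltration x y n ≤ ⨆ n, cellFiltration y x n :=
    iSup_mono fun n => sup_le_sup_left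
      (measurable_swap.comp (comap_measurable (cellPair y x n))).comap_le _
  exact le_antisymm (hle x y) (hle y x)

lemma le_iSup_cellFiltration :
    cylinderEvents (({x, y} ∪ sample).sym2 \ {s(x, y)}) ≤ ⨆ n, cellFiltration x y n := by
  have hright {z : Vertex Time} (hz : z = y ∨ z ∈ sample) :
      Measurable[⨆ n, cellFiltration x y n] fun ω : Sym2 (Vertex Time) → Bool => ω s(y, z) :=
    iSup_cellFiltration_comm (x := y) ▸ measurable_apply_left_iSup_cellFiltration hz
  refine iSup₂_le fun e he => Measurable.comap_le ?_
  induction e with | _ z z'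
  obtain ⟨h, hne⟩ := he
  obtain ⟨hz, hz'⟩ := Set.mk_mem_sym2_iff.1 h
  obtain (rfl | rfl) | hz := hz <;> obtain (rfl | rfl) | hz' := hz'
  · exact measurable_apply_left_iSup_cellFiltration (.inl rfl)
  · exact absurd rfl hne
  · exact measurable_apply_left_iSup_cellFiltration (.inr hz')
  · exact absurd Sym2.eq_swap hne
  · exact hright (.inl rfl)
  · exact hright (.inr hz')
  · exact Sym2.eq_swap ▸ measurable_apply_left_iSup_cellFiltration (.inr hz)
  · exact Sym2.eq_swap ▸ hright (.inr hz)
  · exact (measurable_cylinderEvent_apply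
      (Set.mk_mem_sym2_iff.2 ⟨sample_subset_late 3 hz, sample_subset_late 3 hz'⟩)).mono
      (le_sup_left.trans (le_iSup (fun n => cellFiltration x y n) 0)) le_rfl

end Cells

section Triangles

open MeasureTheory

/-- The indicator of an edge. -/
noncomputable def edgeRV (e : Sym2 (Vertex Time)) (ω : Sym2 (Vertex Time) → Bool) : ℝ :=
  ind (ω e = true)

lemma unitRV_edgeRV {e : Sym2 (Vertex Time)} {D : Set (Sym2 (Vertex Time))} (he : e ∈ D) :
    UnitRV (cylinderEvents D) (edgeRV e) :=
  .ind_eq (τ := fun ω : Sym2 (Vertex Time) → Bool => ω e) (measurable_cylinderEvent_apply he) true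

lemma unitRV_edgeRV_pi (e : Sym2 (Vertex Time)) : UnitRV MeasurableSpace.pi (edgeRV e) :=
  (unitRV_edgeRV (Set.mem_univ e)).mono cylinderEvents_le_pi

variable {x y : Vertex Time} {U : Set (Vertex Time)} {n : ℕ}

lemma unitRV_ind_cell (hx : x ∈ U) (hU : sample ⊆ U) (i : Bool × (Fin n → Bool)) :
    UnitRV (cylinderEvents U.sym2) fun ω => ind (cell x n ω = i) :=
  .ind_eq (measurable_cell_sym2 hx hU) i

lemma unitRV_ind_cellPair (hx : x ∈ U) (hy : y ∈ U) (hU : sample ⊆ U)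
    (p : (Bool × (Fin n → Bool)) × (Bool × (Fin n → Bool))) :
    UnitRV (cylinderEvents U.sym2) fun ω => ind (cellPair x y n ω = p) :=
  .ind_eq ((measurable_cell_sym2 hx hU).prodMk (measurable_cell_sym2 hy hU)) p

lemma cell_root_comp (i : Fin 3) (ω : Sym2 (Vertex Time) → Bool) :
    cell (root i) n (fun e => ω (e.map (putRoots apexTime))) = cell (apex i) n ω := by
  refine Prod.ext rfl (funext fun k => ?_)
  simp only [cell, Sym2.map_mk, putRoots_of_mem_late _ (sampleEnum_mem k)]
  rfl

variable {G Z : Type*} [Group G] {I : Mean G} {S : BiSystem G Z} {f : Z → Bool}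

lemma edgeVal_one {i j : Fin 3} (h : i ≠ j) (z : Z) : edgeVal S f z s((i, 1), (j, 1)) = f z := by
  fin_cases i <;> fin_cases j <;> simp_all [edgeVal, orientedVal, S.act_one]

variable {P : Measure (Sym2 (Vertex Time) → Bool)} [IsProbabilityMeasure P]
  (hP : IsArrayMeasure I S f P)

namespace IsArrayMeasure

include hP

lemma ae_eq_of_edgeVal_eq {e e' : Sym2 (Vertex Time)}
    (h : ∀ v z, edgeVal S f z (e.map (label (1 : Fin 3 → G) v)) =
      edgeVal S f z (e'.map (label 1 v))) : ∀ᵐ ω ∂P, ω e = ω e' := by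
  have hne : ∀ c : Bool, ∀ᵐ ω ∂P, ¬(ω e = c ∧ ω e' = !c) := by
    intro c
    have hc := hP (fun b : Bool => bif b then e else e') Finset.univ fun b => bif b then c else !c
    have hzero : ∀ v z, ind (∀ b ∈ Finset.univ,
        edgeVal S f z (Sym2.map (label 1 v) (bif b then e else e')) = bif b then c else !c) = 0 :=
      fun v z => ind_of_not (by cases c <;> simp [h])
    simp only [patternProb, matchProb, hzero, Mean.const] at hc
    rw [measureReal_eq_zero_iff] at hc
    rw [ae_iff]
    simpa only [not_not, Finset.mem_univ, true_imp_iff, Bool.forall_bool, cond_true, cond_false,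
      and_comm] using hc
  filter_upwards [hne true, hne false] with ω h1 h2
  cases h : ω e <;> cases h' : ω e' <;> simp_all

lemma ae_eq_root_edge {i j : Fin 3} (h : i ≠ j) :
    ∀ᵐ ω ∂P, ω s(root 0, root 1) = ω s(root i, root j) :=
  hP.ae_eq_of_edgeVal_eq fun v z =>
    (edgeVal_one (i := 0) (j := 1) (by decide) z).trans (edgeVal_one h z).symm

lemma sameCellLaw (hI : I.IsInvariant) {i j : Fin 3} (hij : i ≠ j) :
    SameCellLaw P lateEvents (edgeRV s(root 0, root 1)) (cellPair (root i) (root j) n)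
      (edgeRV s(apex i, apex j)) (cellPair (apex i) (apex j) n) where
  left := unitRV_edgeRV_pi _
  right := unitRV_edgeRV_pi _
  left_cell := measurable_cell_pi.prodMk measurable_cell_pi
  right_cell := measurable_cell_pi.prodMk measurable_cell_pi
  integral_eq p g hg := by
    obtain ⟨k, hki, hkj⟩ : ∃ k, k ≠ i ∧ k ≠ j := by decide +revert
    let U : Set (Vertex Time) := {root i, root j} ∪ late (frontTime 3)
    have hi : root i ∈ U := .inl (.inl rfl)
    have hj : root j ∈ U := .inl (.inr rfl)
    have hk : root k ∉ U := by
      rintro ((h | h) | h)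
      exacts [hki (congrArg Prod.fst h), hkj (congrArg Prod.fst h), root_notMem_late _ _ h]
    have hU : U ⊆ patternVertices := Set.union_subset_union_left _
      (Set.insert_subset ⟨i, rfl⟩ (Set.singleton_subset_iff.2 ⟨j, rfl⟩))
    have hlate : late (frontTime 3) ⊆ U := Set.subset_union_right
    have h := (hP.sameLaw_putRoots hI hU hk).integral_eq
      (((unitRV_edgeRV (Set.mk_mem_sym2_iff.2 ⟨hi, hj⟩)).mul (unitRV_ind_cellPair hi hj
        ((sample_subset_late 3).trans hlate) p)).mul (hg.mono (cylinderEvents_mono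
          (sym2_mono hlate))))
    have hedge : ∀ᵐ ω ∂P, edgeRV s(root 0, root 1) ω = edgeRV s(root i, root j) ω := by
      filter_upwards [hP.ae_eq_root_edge hij] with ω hω
      rw [edgeRV, edgeRV, hω]
    have hmoved : ∀ ω, g (fun e => ω (e.map (putRoots apexTime))) = g ω := fun ω =>
      hg.congr_of_cylinderEvents fun e he => congrArg ω <| (Sym2.map_congr fun x hx =>
        putRoots_of_mem_late _ (Set.mem_sym2_iff_subset.1 he hx)).trans (congrFun Sym2.map_id e)
    simp only [cellPair, cell_root_comp, hmoved] at h
    refine Eq.trans (integral_congr_ae ?_) h.symm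
    filter_upwards [hedge] with ω hω
    rw [hω]
    rfl

lemma condUncorrelated_cell_zero {Y : (Sym2 (Vertex Time) → Bool) → ℝ}
    (hY : UnitRV (cylinderEvents (late (frontTime 1)).sym2) Y) (i : Bool × (Fin n → Bool)) :
    CondUncorrelated P lateEvents (fun ω => ind (cell (apex 0) n ω = i)) Y :=
  hP.condUncorrelated_of_late (W := {apex 0} ∪ sample) (by norm_num)
    (Set.union_subset_union_left _ (Set.singleton_subset_iff.2 ⟨0, Nat.one_pos, rfl⟩))
    (unitRV_ind_cell (.inl rfl) Set.subset_union_right i) hY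

lemma condUncorrelated_cell_one (hI : I.IsInvariant) {Y : (Sym2 (Vertex Time) → Bool) → ℝ}
    (hY : UnitRV (cylinderEvents (seen 0 2).sym2) Y) (i : Bool × (Fin n → Bool)) :
    CondUncorrelated P lateEvents Y fun ω => ind (cell (apex 1) n ω = i) :=
  hP.condUncorrelated_of_insert_late hI hY
    (unitRV_ind_cell (.inl rfl) ((sample_subset_late 3).trans (Set.subset_insert _ _)) i)

lemma condUncorrelated_cell_two {Y : (Sym2 (Vertex Time) → Bool) → ℝ}
    (hY : UnitRV (cylinderEvents (seen 0 1).sym2) Y) (i : Bool × (Fin n → Bool)) :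
    CondUncorrelated P lateEvents Y fun ω => ind (cell (apex 2) n ω = i) := by
  have hmem : apex 2 ∈ late (frontTime 2) := apex_mem_late le_rfl
  refine hP.condUncorrelated_of_late (by norm_num) (Set.union_subset_union_left _ ?_) hY
    (unitRV_ind_cell hmem (sample_subset_late 2) i)
  exact Set.insert_subset ⟨0, Nat.two_pos, rfl⟩
    (Set.singleton_subset_iff.2 ⟨1, Nat.one_lt_two, rfl⟩)

lemma indepTriangle (hI : I.IsInvariant) {N N' : (Sym2 (Vertex Time) → Bool) → ℝ}
    (hN : UnitRV (seenEvents 0 1) N) (hN' : UnitRV (seenEvents 0 2) N') :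
    IndepTriangle P lateEvents (cell (apex 0) n) (cell (apex 1) n) (cell (apex 2) n)
      (edgeRV s(apex 1, apex 2)) N N' := by
  have hs : sample ⊆ late (frontTime 1) := sample_subset_late 1
  have h1 : apex 1 ∈ late (frontTime 1) := apex_mem_late le_rfl
  have h2 : apex 2 ∈ late (frontTime 1) := apex_mem_late one_le_two
  have hpair (j : Fin 3) (p) :
      UnitRV (cylinderEvents (seen 0 j).sym2) fun ω => ind (cellPair (apex 0) (apex j) n ω = p) :=
    unitRV_ind_cellPair (left_mem_seen 0 j) (right_mem_seen 0 j) (sample_subset_seen 0 j) p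
  have hsdiff {D D' : Set (Sym2 (Vertex Time))} : cylinderEvents (D \ D') ≤ cylinderEvents D :=
    cylinderEvents_mono (X := fun _ => Bool) Set.sdiff_subset
  exact {
    meas_A := measurable_cell_pi
    meas_B := measurable_cell_pi
    meas_C := measurable_cell_pi
    unit_BC := unitRV_edgeRV_pi _
    unit_AB := hN.mono cylinderEvents_le_pi
    unit_AC := hN'.mono cylinderEvents_le_pi
    indep_AB i j := hP.condUncorrelated_cell_zero (unitRV_ind_cell h1 hs j) i
    indep_AC i j := hP.condUncorrelated_cell_zero (unitRV_ind_cell h2 hs j) i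
    indep_BC i j := hP.condUncorrelated_cell_two
      (unitRV_ind_cell (right_mem_seen 0 1) (sample_subset_seen 0 1) i) j
    indep_A_BC i p := (hP.condUncorrelated_cell_zero ((unitRV_ind_cellPair h1 h2 hs p).mul
      (unitRV_edgeRV (Set.mk_mem_sym2_iff.2 ⟨h1, h2⟩))) i).symm
    indep_C_AB i p := hP.condUncorrelated_cell_two ((hpair 1 p).mul (hN.mono hsdiff)) i
    indep_B_AC i p := hP.condUncorrelated_cell_one hI ((hpair 2 p).mul (hN'.mono hsdiff)) i }

end IsArrayMeasure

end Triangles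

section Corners

open MeasureTheory

/-- The point `z` is the apex of a corner of size `g` in the set given by `f`: the points `z`, `g z`
and `z g` all belong to that set. -/
def BiSystem.IsCorner {G Z : Type*} [Group G] (S : BiSystem G Z) (f : Z → Bool) (g : G) (z : Z) :
    Prop := f z = true ∧ f (S.act g 1 z) = true ∧ f (S.act 1 g z) = true

lemma apex_injective : Injective apex := fun _ _ h => congrArg Prod.fst h

lemma apex_ne {i j : Fin 3} (h : i ≠ j) : apex i ≠ apex j := apex_injective.ne h

lemma seenEvents_le_sdiff :
    seenEvents 0 1 ≤ cylinderEvents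
      ((Set.range apex ∪ late (frontTime 3)).sym2 \ {s(apex 0, apex 2)}) := by
  have hsub : seen 0 1 ⊆ Set.range apex ∪ late (frontTime 3) :=
    Set.union_subset_union (by grind) (sample_subset_late 3)
  have hapex : apex 2 ∉ seen 0 1 := by
    rintro ((h | h) | h)
    exacts [apex_ne (by decide) h, apex_ne (by decide) h, apex_notMem_sample 2 h]
  refine cylinderEvents_mono (Set.subset_sdiff_singleton
    (Set.sdiff_subset.trans (sym2_mono hsub)) fun h => hapex ?_)
  exact (Set.mk_mem_sym2_iff.1 h.1).2

variable {G Z : Type*} [Group G] {I : Mean G} {S : BiSystem G Z} {f : Z → Bool}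
  {P : Measure (Sym2 (Vertex Time) → Bool)}

namespace IsArrayMeasure

section Integrals

variable (hP : IsArrayMeasure I S f P) (hI : I.IsInvariant)

include hP hI

lemma integral_edge : ∫ ω, edgeRV s(apex 1, apex 2) ω ∂P = S.mean fun z => ind (f z = true) := by
  have h := hP.real_putRoots hI (σ := 1) rfl (e := fun _ : Unit => s(root 1, root 2))
    (K := Finset.univ) (fun _ _ => ⟨.inl ⟨1, rfl⟩, .inl ⟨2, rfl⟩⟩) fun _ => true
  rw [← integral_ind_cylinder] at h
  have hval (g : G) : patternProb I S f ![1, 1, g] (fun _ : Unit => s(root 1, root 2))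
      Finset.univ (fun _ => true) = S.mean fun z => ind (f z = true) := by
    simp only [← S.mean_act g 1 _ (.ind fun z => f z = true)]
    refine Eq.trans ?_ (Mean.const (arrayMean (T := Time) (tupleMean I 3) 1) _)
    simp [patternProb, matchProb, label, root, edgeVal, orientedVal]
  simp only [hval, Mean.const] at h
  refine Eq.trans (integral_congr_ae (ae_of_all _ fun ω => ind_congr ?_)) h
  simp
  rfl

lemma integral_corner :
    ∫ ω, edgeRV s(apex 0, apex 1) ω *
      (edgeRV s(apex 0, apex 2) ω * edgeRV s(apex 1, apex 2) ω) ∂P =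
    I fun g => S.mean fun z => ind (S.IsCorner f g z) := by
  have h := hP.real_putRoots hI (σ := 1) rfl
    (e := ![s(root 0, root 1), s(root 0, root 2), s(root 1, root 2)]) (K := Finset.univ)
    (fun j _ => by fin_cases j <;> exact ⟨.inl ⟨_, rfl⟩, .inl ⟨_, rfl⟩⟩) fun _ => true
  rw [← integral_ind_cylinder] at h
  have hval (g : G) : patternProb I S f ![1, 1, g]
      ![s(root 0, root 1), s(root 0, root 2), s(root 1, root 2)] Finset.univ (fun _ => true) =
      S.mean fun z => ind (S.IsCorner f g z) := by
    refine Eq.trans ?_ (Mean.const (arrayMean (T := Time) (tupleMean I 3) 1) _)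
    simp [patternProb, matchProb, label, root, edgeVal, orientedVal, S.act_one, BiSystem.IsCorner,
      Fin.forall_fin_succ, and_comm (a := f (S.act g 1 _) = true)]
  simp only [hval] at h
  refine Eq.trans (integral_congr_ae (ae_of_all _ fun ω => ?_)) h
  simp only [edgeRV, ← ind_and]
  refine ind_congr ?_
  simp [Fin.forall_fin_succ]
  rfl

end Integrals

variable [IsProbabilityMeasure P] (hP : IsArrayMeasure I S f P) (hI : I.IsInvariant)

include hP hI

lemma ae_edgeRV_le (h0 : ∫ ω, edgeRV s(apex 0, apex 1) ω *
      (edgeRV s(apex 0, apex 2) ω * edgeRV s(apex 1, apex 2) ω) ∂P = 0) :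
    ∀ᵐ ω ∂P, edgeRV s(apex 1, apex 2) ω ≤
      ind (condE P (seenEvents 0 1) (edgeRV s(apex 0, apex 1)) ω = 0) +
        ind (condE P (seenEvents 0 2) (edgeRV s(apex 0, apex 2)) ω = 0) := by
  have h2 : apex 2 ∈ {apex 0, apex 1} ∪ late (frontTime 2) := .inr (apex_mem_late le_rfl)
  have h02 : s(apex 0, apex 2) ∈ ({apex 0, apex 1} ∪ late (frontTime 2)).sym2 \
      {s(apex 0, apex 1)} :=
    ⟨Set.mk_mem_sym2_iff.2 ⟨.inl (.inl rfl), h2⟩, by simp [apex_injective.eq_iff]⟩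
  have h12 : s(apex 1, apex 2) ∈ ({apex 0, apex 1} ∪ late (frontTime 2)).sym2 \
      {s(apex 0, apex 1)} :=
    ⟨Set.mk_mem_sym2_iff.2 ⟨.inl (.inr rfl), h2⟩, by simp [apex_injective.eq_iff]⟩
  have h12' : s(apex 1, apex 2) ∈ (Set.range apex ∪ late (frontTime 3)).sym2 \
      {s(apex 0, apex 2)} :=
    ⟨Set.mk_mem_sym2_iff.2 ⟨.inl ⟨1, rfl⟩, .inl ⟨2, rfl⟩⟩,
      by simp [apex_injective.eq_iff]⟩
  exact ae_le_ind_add_ind_of_integral_eq_zero cylinderEvents_le_pi cylinderEvents_le_pi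
    (unitRV_edgeRV_pi _) (unitRV_edgeRV_pi _) (unitRV_edgeRV h02) (unitRV_edgeRV h12)
    (unitRV_edgeRV h12') seenEvents_le_sdiff (hP.condE_edge_zero_one_ae_eq (unitRV_edgeRV rfl))
    (hP.condE_edge_zero_two_ae_eq hI (unitRV_edgeRV rfl)) h0

omit hI in
lemma tendsto_zero_one : Tendsto (fun n => ∫ ω,
    condE P (cellFiltration (apex 0) (apex 1) n) (edgeRV s(apex 0, apex 1)) ω *
      ind (condE P (seenEvents 0 1) (edgeRV s(apex 0, apex 1)) ω = 0) ∂P) atTop (𝓝 0) :=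
  tendsto_integral_condE_mul_ind _ le_iSup_cellFiltration
    (iSup_cellFiltration_le (apex_ne (by decide)) (apex_notMem_late (apexTime_lt _))
      (apex_notMem_late (apexTime_lt _)) (Set.union_subset_union_right _
        (late_anti (strictMono_frontTime.monotone (by norm_num)))))
    cylinderEvents_le_pi (unitRV_edgeRV_pi _) (hP.condE_edge_zero_one_ae_eq (unitRV_edgeRV rfl))

lemma tendsto_zero_two : Tendsto (fun n => ∫ ω,
    condE P (cellFiltration (apex 0) (apex 2) n) (edgeRV s(apex 0, apex 2)) ω *
      ind (condE P (seenEvents 0 2) (edgeRV s(apex 0, apex 2)) ω = 0) ∂P) atTop (𝓝 0) :=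
  tendsto_integral_condE_mul_ind _ le_iSup_cellFiltration
    (iSup_cellFiltration_le (apex_ne (by decide)) (apex_notMem_late (apexTime_lt _))
      (apex_notMem_late (apexTime_lt _)) (Set.union_subset_union_left _ (by grind)))
    cylinderEvents_le_pi (unitRV_edgeRV_pi _)
    (hP.condE_edge_zero_two_ae_eq hI (unitRV_edgeRV rfl))

end IsArrayMeasure

lemma corner_pos (hI : I.IsInvariant) (S : BiSystem G Z) (f : Z → Bool)
    (hf : 0 < S.mean fun z => ind (f z = true)) :
    0 < I fun g => S.mean fun z => ind (S.IsCorner f g z) := by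
  obtain ⟨P, _, hP⟩ := exists_isArrayMeasure I S f
  rw [← hP.integral_corner hI]
  refine (integral_nonneg ((unitRV_edgeRV_pi _).mul
    ((unitRV_edgeRV_pi _).mul (unitRV_edgeRV_pi _))).nonneg).lt_of_ne' fun h0 => ?_
  have hN {i j : Fin 3} {F : (Sym2 (Vertex Time) → Bool) → ℝ} :
      UnitRV (seenEvents i j) fun ω => ind (condE P (seenEvents i j) F ω = 0) :=
    .ind_eq (unitRV_condE _).meas 0
  have hcount (n : ℕ) := (hP.indepTriangle (n := n) hI hN hN).sq_integral_le cylinderEvents_le_pi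
    (hP.ae_edgeRV_le hI h0) (hP.sameCellLaw hI (by decide)) (hP.sameCellLaw hI (by decide))
    (hP.sameCellLaw hI (by decide))
  have hsq := ge_of_tendsto' (hP.tendsto_zero_one.add (hP.tendsto_zero_two hI)) hcount
  rw [hP.integral_edge hI, add_zero] at hsq
  exact hsq.not_gt (pow_pos hf 2)

end Corners

section CornerSystems

universe u

variable {G : Type*} [Group G]

/-- The product of two systems. -/
def BiSystem.prod {Z Z' : Type*} (S : BiSystem G Z) (S' : BiSystem G Z') :
    BiSystem G (Z × Z') where
  act p q z := (S.act p q z.1, S'.act p q z.2)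
  act_one z := by rw [S.act_one, S'.act_one]
  act_act p q p' q' z := by rw [S.act_act, S'.act_act]
  mean := S.mean.bind fun z => S'.mean.map fun z' => (z, z')
  mean_act p q f hf := by
    obtain ⟨C, hC⟩ := hf
    have hS' (z : Z) := S'.mean_act p q (fun z' => f (S.act p q z, z')) ⟨C, fun _ => hC _⟩
    refine Eq.trans (congrArg S.mean.toFun (funext hS')) ?_
    exact S.mean_act p q (fun z => S'.mean fun z' => f (z, z'))
      (Mean.bddFun (m := fun _ => S'.mean) ⟨C, fun _ _ => hC _⟩)

lemma BiSystem.prod_mean_ind_and {Z Z' : Type*} (S : BiSystem G Z) (S' : BiSystem G Z')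
    (p : Z → Prop) (p' : Z' → Prop) :
    ((S.prod S').mean fun z => ind (p z.1 ∧ p' z.2)) =
      (S.mean fun z => ind (p z)) * S'.mean fun z => ind (p' z) := by
  change (S.mean fun z => S'.mean fun z' => ind (p z ∧ p' z')) = _
  simp only [ind_and, fun z => S'.mean.const_mul (ind (p z)) (.ind p'),
    mul_comm _ (S'.mean.toFun _), S.mean.const_mul _ (.ind p)]

/-- The one-point system. -/
def BiSystem.punit : BiSystem G PUnit.{u + 1} where
  act _ _ z := z
  act_one _ := rfl
  act_act _ _ _ _ _ := rfl
  mean := .dirac ⟨⟩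
  mean_act _ _ _ _ := rfl

variable {ι : Type*} {Z : ι → Type u}

lemma exists_mean_eq_prod (S : ∀ i, BiSystem G (Z i)) (f : ∀ i, Z i → Bool) (s : Finset ι) :
    ∃ (Z' : Type u) (S' : BiSystem G Z') (f' : Z' → Bool),
      (S'.mean fun z => ind (f' z = true)) = ∏ i ∈ s, (S i).mean (fun z => ind (f i z = true)) ∧
      ∀ g, (S'.mean fun z => ind (S'.IsCorner f' g z)) =
        ∏ i ∈ s, (S i).mean fun z => ind ((S i).IsCorner (f i) g z) := by
  classical
  induction s using Finset.induction_on with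
  | empty => exact ⟨PUnit, .punit, fun _ => true, by simp [Mean.const],
      fun g => by simp [BiSystem.IsCorner, Mean.const]⟩
  | insert i s hi ih =>
    obtain ⟨Z', S', f', hf, hcorner⟩ := ih
    refine ⟨Z i × Z', (S i).prod S', fun z => f i z.1 && f' z.2, ?_, fun g => ?_⟩
    · rw [Finset.prod_insert hi, ← hf, ← BiSystem.prod_mean_ind_and]
      simp only [Bool.and_eq_true]
    · rw [Finset.prod_insert hi, ← hcorner, ← BiSystem.prod_mean_ind_and]
      refine congrArg ((S i).prod S').mean.toFun (funext fun z => ind_congr ?_)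
      simp only [BiSystem.IsCorner, BiSystem.prod, Bool.and_eq_true]
      tauto

lemma prod_corner_pos {I : Mean G} (hI : I.IsInvariant) (S : ∀ i, BiSystem G (Z i))
    (f : ∀ i, Z i → Bool) (s : Finset ι)
    (hf : ∀ i ∈ s, 0 < (S i).mean fun z => ind (f i z = true)) :
    0 < I fun g => ∏ i ∈ s, (S i).mean fun z => ind ((S i).IsCorner (f i) g z) := by
  obtain ⟨Z', S', f', hf', hcorner⟩ := exists_mean_eq_prod S f s
  simp only [← hcorner]
  exact corner_pos hI S' f' (hf' ▸ Finset.prod_pos hf)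

end CornerSystems

section Rich

variable {G κ : Type*} [Group G]

/-- Multiplying the last entry of a tuple from the left and the first one from the right. -/
def shift (p q : G) {n : ℕ} (t : Fin n → G) (i : Fin n) : G :=
  (if i.val + 1 = n then p else 1) * t i * (if i.val = 0 then q else 1)

/-- The system of tuples of length `n`, on which a group acts by `shift`. -/
def tupleSystem {I : Mean G} (hI : I.IsInvariant) (n : ℕ) : BiSystem G (Fin n → G) where
  act p q := shift p q
  act_one t := by ext i; simp [shift]
  act_act p q p' q' t := by
    ext i
    simp only [shift]
    split_ifs <;> simp [mul_assoc]
  mean := tupleMean I n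
  mean_act p q _ hf := tupleMean_map I (θ := fun i x => (if i.val + 1 = n then p else 1) * x *
    (if i.val = 0 then q else 1)) (fun _ _ hF => hI.mul_mul _ _ hF) hf

/-- The tuples built up by successive corners with all colours equal to `a`: the first entry is the
size of a corner in the set of shorter tuples of this kind. -/
def IsRich (c : G → κ) (a : κ) : (n : ℕ) → (Fin n → G) → Prop
  | 0, _ => True
  | n + 1, t => c (t 0) = a ∧ IsRich c a n (Fin.tail t) ∧
      IsRich c a n (shift (t 0) 1 (Fin.tail t)) ∧ IsRich c a n (shift 1 (t 0) (Fin.tail t))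

/-- The mean of the set of rich tuples. -/
noncomputable def richMean (I : Mean G) (c : G → κ) (a : κ) (n : ℕ) : ℝ :=
  tupleMean I n fun t => ind (IsRich c a n t)

lemma richMean_zero (I : Mean G) (c : G → κ) (a : κ) : richMean I c a 0 = 1 :=
  ind_of trivial

open Classical in
lemma richMean_succ {I : Mean G} (hI : I.IsInvariant) (c : G → κ) (a : κ) (n : ℕ) :
    richMean I c a (n + 1) = I fun g => ind (c g = a) * (tupleSystem hI n).mean fun t =>
      ind ((tupleSystem hI n).IsCorner (fun t => decide (IsRich c a n t)) g t) := by
  rw [richMean, tupleMean_succ]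
  refine congrArg I.toFun (funext fun g => ?_)
  rw [← Mean.const_mul _ _ (.ind _)]
  refine congrArg (tupleMean I n).toFun (funext fun t => ?_)
  rw [← ind_and]
  simp only [BiSystem.IsCorner, decide_eq_true_eq]
  rfl

lemma exists_mean_ind_mul_pos [Fintype κ] {X : Type*} {m : Mean X} {φ : κ → X → ℝ}
    (h0 : ∀ a x, 0 ≤ φ a x) (h1 : ∀ a x, φ a x ≤ 1) (h : 0 < m fun x => ∏ a, φ a x) (c : X → κ) :
    ∃ a, 0 < m fun x => ind (c x = a) * φ a x := by
  classical
  have hb (a : κ) : BddFun fun x => ind (c x = a) * φ a x :=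
    (BddFun.ind _).mul (.of_mem_Icc (h0 a) (h1 a))
  have hle (x : X) : ∏ a, φ a x ≤ ∑ a, ind (c x = a) * φ a x := by
    rw [Finset.sum_eq_single_of_mem _ (Finset.mem_univ (c x)) fun a _ ha => by
        rw [ind_of_not ha.symm, zero_mul],
      ind_of rfl, one_mul, ← Finset.mul_prod_erase _ _ (Finset.mem_univ (c x))]
    exact mul_le_of_le_one_right (h0 _ x) (Finset.prod_le_one (fun a _ => h0 a x) fun a _ => h1 a x)
  have hsum : 0 < ∑ a, m fun x => ind (c x = a) * φ a x := by
    rw [← m.sum _ fun a _ => hb a]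
    exact h.trans_le <| m.mono (.of_mem_Icc (fun x => Finset.prod_nonneg fun a _ => h0 a x)
      fun x => Finset.prod_le_one (fun a _ => h0 a x) fun a _ => h1 a x)
      (.sum _ fun a _ => hb a) hle
  by_contra! hn
  exact hsum.not_ge (Finset.sum_nonpos fun a _ => hn a)

lemma exists_richMean_succ_pos [Finite κ] {I : Mean G} (hI : I.IsInvariant) (c : G → κ)
    {d : κ → ℕ} (h : ∀ a, 0 < richMean I c a (d a)) : ∃ a, 0 < richMean I c a (d a + 1) := by
  classical
  have := Fintype.ofFinite κ
  simp only [richMean_succ hI]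
  refine exists_mean_ind_mul_pos (fun a g => Mean.le_of_forall_ge _ (.ind _) fun _ => ind_nonneg _)
    (fun a g => Mean.le_of_forall_le _ (.ind _) fun _ => ind_le_one _)
    (prod_corner_pos hI (fun a => tupleSystem hI (d a)) _ _ fun a _ => ?_) c
  simp only [decide_eq_true_eq]
  exact h a

lemma exists_apply_of_forall_exists_succ {p : κ → ℕ → Prop} (h0 : ∀ a, p a 0)
    (hs : ∀ d : κ → ℕ, (∀ a, p a (d a)) → ∃ a, p a (d a + 1)) (k : ℕ) : ∃ a, p a k := by
  classical
  obtain ⟨a, ha⟩ := hs (fun a => Nat.findGreatest (p a) k) fun a =>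
    Nat.findGreatest_spec k.zero_le (h0 a)
  have hle : Nat.findGreatest (p a) k ≤ k := Nat.findGreatest_le k
  have hk : Nat.findGreatest (p a) k = k := hle.antisymm <| not_lt.1 fun hlt =>
    Nat.findGreatest_is_greatest (Nat.lt_succ_self _) hlt ha
  exact ⟨a, hk ▸ Nat.findGreatest_spec k.zero_le (h0 a)⟩

lemma exists_richMean_pos [Finite κ] {I : Mean G} (hI : I.IsInvariant) (c : G → κ) (n : ℕ) :
    ∃ a, 0 < richMean I c a n :=
  exists_apply_of_forall_exists_succ (p := fun a n => 0 < richMean I c a n)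
    (fun a => (richMean_zero I c a).symm ▸ one_pos) (fun _ h => exists_richMean_succ_pos hI c h) n

end Rich

section Pattern

variable {G κ : Type*} [Group G]

section OrderedProd

variable {n : ℕ} {x y : Fin n → G} {A B : Finset (Fin n)} {i : Fin n}

lemma orderedProd_congr (h : ∀ a ∈ A, x a = y a) : orderedProd x A = orderedProd y A :=
  congrArg List.prod (List.map_congr_left fun a ha => h a ((Finset.mem_sort _).1 ha))

@[simp] lemma orderedProd_empty (x : Fin n → G) : orderedProd x ∅ = 1 := by simp [orderedProd]

@[simp] lemma orderedProd_singleton (x : Fin n → G) (i : Fin n) : orderedProd x {i} = x i := by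
  simp [orderedProd]

lemma orderedProd_union (x : Fin n → G) (h : ∀ a ∈ A, ∀ b ∈ B, a < b) :
    orderedProd x (A ∪ B) = orderedProd x A * orderedProd x B := by
  have hsort : (A ∪ B).sort = A.sort ++ B.sort := by
    refine List.Perm.eq_of_pairwise (le := (· ≤ ·)) (fun a b _ _ => le_antisymm)
      (Finset.pairwise_sort _ _) ?_ ((List.perm_ext_iff_of_nodup (Finset.sort_nodup _ _) ?_).2 ?_)
    · exact List.pairwise_append.2 ⟨Finset.pairwise_sort _ _, Finset.pairwise_sort _ _,
        fun a ha b hb => (h a ((Finset.mem_sort _).1 ha) b ((Finset.mem_sort _).1 hb)).le⟩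
    · exact List.nodup_append.2 ⟨Finset.sort_nodup _ _, Finset.sort_nodup _ _,
        fun a ha b hb => (h a ((Finset.mem_sort _).1 ha) b ((Finset.mem_sort _).1 hb)).ne⟩
    · simp
  rw [orderedProd, hsort, List.map_append, List.prod_append, orderedProd, orderedProd]

lemma orderedProd_map {m : ℕ} (x : Fin m → G) (A : Finset (Fin n)) {e : Fin n ↪ Fin m}
    (he : StrictMono e) : orderedProd x (A.map e) = orderedProd (x ∘ e) A := by
  have hsort : (A.map e).sort = A.sort.map e :=
    List.Perm.eq_of_pairwise (le := (· ≤ ·)) (fun a b _ _ => le_antisymm)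
      (Finset.pairwise_sort _ _)
      ((Finset.pairwise_sort A (· ≤ ·)).map e fun a b hab => he.monotone hab)
      ((List.perm_ext_iff_of_nodup (Finset.sort_nodup _ _)
        ((Finset.sort_nodup _ _).map e.injective)).2 (by simp))
  rw [orderedProd, hsort, List.map_map, orderedProd]

lemma orderedProd_insert_of_forall_lt (x : Fin n → G) (h : ∀ a ∈ A, a < i) :
    orderedProd x (insert i A) = orderedProd x A * x i := by
  rw [Finset.insert_eq, Finset.union_comm, orderedProd_union x (by simpa using h),
    orderedProd_singleton]

lemma orderedProd_insert_of_forall_gt (x : Fin n → G) (h : ∀ a ∈ A, i < a) :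
    orderedProd x (insert i A) = x i * orderedProd x A := by
  rw [Finset.insert_eq, orderedProd_union x (by simpa using h), orderedProd_singleton]

lemma orderedProd_update_of_notMem (x : Fin n → G) (g : G) (h : i ∉ A) :
    orderedProd (update x i g) A = orderedProd x A :=
  orderedProd_congr fun _ ha => update_of_ne (ne_of_mem_of_not_mem ha h) _ _

lemma orderedProd_update_mul_right (x : Fin n → G) (g : G) (hi : i ∈ A) (h : ∀ a ∈ A, a ≤ i) :
    orderedProd (update x i (x i * g)) A = orderedProd x A * g := by
  have hlt : ∀ a ∈ A.erase i, a < i := fun a ha =>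
    (h a (Finset.mem_of_mem_erase ha)).lt_of_ne (Finset.ne_of_mem_erase ha)
  rw [← Finset.insert_erase hi, orderedProd_insert_of_forall_lt _ hlt,
    orderedProd_insert_of_forall_lt _ hlt, orderedProd_update_of_notMem x _ (A.notMem_erase i),
    update_self, mul_assoc]

lemma orderedProd_update_mul_left (x : Fin n → G) (g : G) (hi : i ∈ A) (h : ∀ a ∈ A, i ≤ a) :
    orderedProd (update x i (g * x i)) A = g * orderedProd x A := by
  have hlt : ∀ a ∈ A.erase i, i < a := fun a ha =>
    (h a (Finset.mem_of_mem_erase ha)).lt_of_ne' (Finset.ne_of_mem_erase ha)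
  rw [← Finset.insert_erase hi, orderedProd_insert_of_forall_gt _ hlt,
    orderedProd_insert_of_forall_gt _ hlt, orderedProd_update_of_notMem x _ (A.notMem_erase i),
    update_self, mul_assoc]

lemma orderedProd_snoc_map_castSucc (x : Fin n → G) (g : G) (A : Finset (Fin n)) :
    orderedProd (Fin.snoc x g : Fin (n + 1) → G) (A.map Fin.castSuccEmb) = orderedProd x A := by
  rw [orderedProd_map _ _ Fin.strictMono_castSucc]
  exact orderedProd_congr fun a _ => Fin.snoc_castSucc (α := fun _ => G) g x a

lemma orderedProd_snoc_insert_last (x : Fin n → G) (g : G) (A : Finset (Fin n)) :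
    orderedProd (Fin.snoc x g : Fin (n + 1) → G) (insert (Fin.last n) (A.map Fin.castSuccEmb)) =
      orderedProd x A * g := by
  rw [orderedProd_insert_of_forall_lt, orderedProd_snoc_map_castSucc, Fin.snoc_last]
  simp [Fin.castSucc_lt_last]

end OrderedProd

lemma exists_eq_map_castSucc_or {n : ℕ} (A : Finset (Fin (n + 1))) :
    ∃ B : Finset (Fin n), A = B.map Fin.castSuccEmb ∨
      A = insert (Fin.last n) (B.map Fin.castSuccEmb) := by
  refine ⟨Finset.univ.filter fun i => i.castSucc ∈ A, ?_⟩
  by_cases h : Fin.last n ∈ A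
  · refine .inr (Finset.ext fun i => ?_)
    induction i using Fin.lastCases <;> simp [h, Fin.castSucc_ne_last]
  · refine .inl (Finset.ext fun i => ?_)
    induction i using Fin.lastCases <;> simp [h, Fin.castSucc_ne_last]

lemma map_castSucc_Icc {n : ℕ} (i j : Fin n) :
    (Finset.Icc i j).map Fin.castSuccEmb = Finset.Icc i.castSucc j.castSucc := by
  ext l
  induction l using Fin.lastCases <;> simp

lemma Icc_castSucc_last {n : ℕ} (i : Fin (n + 1)) : Finset.Icc i.castSucc (Fin.last (n + 1)) =
    insert (Fin.last (n + 1)) ((Finset.Icc i (Fin.last n)).map Fin.castSuccEmb) := by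
  ext l
  induction l using Fin.lastCases <;> simp [Fin.le_last, Fin.castSucc_ne_last]

section Snoc

variable {k : ℕ} (x : Fin (k + 1) → G) (g : G)

lemma orderedProd_snoc_Icc_mem {i j : Fin (k + 2)} (hij : i ≤ j) :
    orderedProd (Fin.snoc x g : Fin (k + 2) → G) (Finset.Icc i j) ∈
      {g} ∪ productPattern x ∪ productPattern (update x (Fin.last k) (x (Fin.last k) * g)) := by
  induction j using Fin.lastCases with
  | cast j =>
    induction i using Fin.lastCases with
    | cast i =>
      refine .inl (.inr (.inl ⟨i, j, by simpa using hij, ?_⟩))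
      rw [← map_castSucc_Icc, orderedProd_snoc_map_castSucc]
    | last => exact absurd hij (Fin.castSucc_lt_last j).not_ge
  | last =>
    induction i using Fin.lastCases with
    | cast i =>
      refine .inr (.inl ⟨i, Fin.last k, Fin.le_last i, ?_⟩)
      rw [Icc_castSucc_last, orderedProd_snoc_insert_last, orderedProd_update_mul_right]
      exacts [Finset.right_mem_Icc.2 (Fin.le_last i), fun a _ => Fin.le_last a]
    | last =>
      refine .inl (.inl ?_)
      rw [Finset.Icc_self, orderedProd_singleton, Fin.snoc_last]
      rfl

lemma orderedProd_snoc_mul_Iic_mem {j : Fin (k + 1)} {A : Finset (Fin (k + 2))}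
    (hA : A ⊆ Finset.Ioi j.castSucc) :
    orderedProd (Fin.snoc x g : Fin (k + 2) → G) A *
        orderedProd (Fin.snoc x g : Fin (k + 2) → G) (Finset.Iic j.castSucc) ∈
      productPattern x ∪ productPattern (update x 0 (g * x 0)) := by
  have hIic : Finset.Iic j.castSucc = (Finset.Iic j).map Fin.castSuccEmb := by
    rw [← Finset.Icc_bot, ← Finset.Icc_bot, map_castSucc_Icc]
    rfl
  obtain ⟨B, hB⟩ := exists_eq_map_castSucc_or A
  have hBj : B ⊆ Finset.Ioi j := fun b hb => by
    have hb' : b.castSucc ∈ A := by rcases hB with rfl | rfl <;> simp [hb]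
    simpa using hA hb'
  have h0 : (0 : Fin (k + 1)) ∉ B := fun h =>
    ((Fin.zero_le j).trans_lt (Finset.mem_Ioi.1 (hBj h))).false
  rw [hIic, orderedProd_snoc_map_castSucc]
  rcases hB with rfl | rfl
  · exact .inl (.inr ⟨j, B, hBj, by rw [orderedProd_snoc_map_castSucc]⟩)
  · refine .inr (.inr ⟨j, B, hBj, ?_⟩)
    rw [orderedProd_snoc_insert_last, orderedProd_update_of_notMem x _ h0,
      orderedProd_update_mul_left x g (by simp) fun a _ => Fin.zero_le a, mul_assoc]

lemma productPattern_snoc_subset :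
    productPattern (Fin.snoc x g : Fin (k + 2) → G) ⊆ {g} ∪ productPattern x ∪
      productPattern (update x (Fin.last k) (x (Fin.last k) * g)) ∪
      productPattern (update x 0 (g * x 0)) := by
  rintro _ (⟨i, j, hij, rfl⟩ | ⟨j, A, hA, rfl⟩)
  · exact .inl (orderedProd_snoc_Icc_mem x g hij)
  induction j using Fin.lastCases with
  | last =>
    obtain rfl : A = ∅ := Finset.subset_empty.1 fun b hb =>
      absurd (Finset.mem_Ioi.1 (hA hb)) (Fin.le_last b).not_gt
    rw [orderedProd_empty, one_mul, ← Finset.Icc_bot]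
    exact .inl (orderedProd_snoc_Icc_mem x g bot_le)
  | cast j =>
    rcases orderedProd_snoc_mul_Iic_mem x g hA with h | h
    exacts [.inl (.inl (.inr h)), .inr h]

end Snoc

lemma productPattern_fin_one (x : Fin 1 → G) : productPattern x ⊆ {x 0} := by
  have hsub (i j : Fin 1) : i = j := Subsingleton.elim i j
  rintro _ (⟨i, j, -, rfl⟩ | ⟨j, A, hA, rfl⟩)
  · rw [hsub i 0, hsub j 0, Finset.Icc_self, orderedProd_singleton]
    rfl
  · obtain rfl : A = ∅ := Finset.subset_empty.1 fun b hb =>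
      absurd (hsub j b) (Finset.mem_Ioi.1 (hA hb)).ne
    rw [hsub j 0, orderedProd_empty, one_mul]
    exact orderedProd_singleton x 0

lemma insert_subset_productPattern (x y : G) : {x, y, x * y, y * x} ⊆ productPattern ![x, y] := by
  rintro _ (rfl | rfl | rfl | rfl)
  · exact .inl ⟨0, 0, le_rfl, by simp⟩
  · exact .inl ⟨1, 1, le_rfl, by simp⟩
  · refine .inl ⟨0, 1, zero_le_one, ?_⟩
    rw [show Finset.Icc (0 : Fin 2) 1 = {0} ∪ {1} from rfl, orderedProd_union _ (by simp)]
    simp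
  · refine .inr ⟨0, {1}, by simp, ?_⟩
    rw [show Finset.Iic (0 : Fin 2) = {0} from rfl]
    simp

lemma rev_eq_snoc {X : Type*} {n : ℕ} (t : Fin (n + 1) → X) :
    (fun i : Fin (n + 1) => t i.rev) =
      Fin.snoc (fun i => Fin.tail t i.rev) (t 0) := by
  ext i
  induction i using Fin.lastCases <;> simp [Fin.rev_castSucc, Fin.tail]

lemma shift_one_right_rev {n : ℕ} (g : G) (t : Fin (n + 1) → G) :
    (fun i : Fin (n + 1) => shift g 1 t i.rev) =
      update (fun i => t i.rev) 0 (g * t (Fin.rev 0)) := by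
  ext i
  obtain rfl | hi := eq_or_ne i 0
  · simp [shift]
  · have hn : n - i.val ≠ n := by grind
    simp [shift, hi, hn]

lemma shift_one_left_rev {n : ℕ} (g : G) (t : Fin (n + 1) → G) :
    (fun i : Fin (n + 1) => shift 1 g t i.rev) =
      update (fun i => t i.rev) (Fin.last n) (t (Fin.rev (Fin.last n)) * g) := by
  ext i
  obtain rfl | hi := eq_or_ne i (Fin.last n)
  · simp [shift]
  · have hn : n - i.val ≠ 0 := by grind
    simp [shift, hi, hn]

lemma IsRich.eq_of_mem_productPattern {c : G → κ} {a : κ} {k : ℕ} {t : Fin (k + 1) → G}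
    (h : IsRich c a (k + 1) t) : ∀ g ∈ productPattern fun i => t i.rev, c g = a := by
  induction k with
  | zero =>
    intro g hg
    rw [productPattern_fin_one _ hg]
    exact h.1
  | succ k ih =>
    obtain ⟨h0, hx, hleft, hright⟩ := h
    intro g hg
    rw [rev_eq_snoc] at hg
    have hl := ih hleft
    have hr := ih hright
    rw [shift_one_right_rev] at hl
    rw [shift_one_left_rev] at hr
    rcases productPattern_snoc_subset _ _ hg with ((rfl | hg) | hg) | hg
    exacts [h0, ih hx g hg, hr g hg, hl g hg]

end Pattern

section Content

open MeasureTheory (AddContent addContent_mono)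

variable {G κ : Type*} {μ : AddContent ℝ≥0 (Set.univ : Set (Set G))}

lemma Many.mono {n : ℕ} {p q : (Fin n → G) → Prop} (hp : Many μ n p) (h : ∀ t, p t → q t) :
    Many μ n q := by
  induction n with
  | zero => exact h _ hp
  | succ n ih =>
    exact hp.trans_le (addContent_mono isSetRing_univ.isSetSemiring trivial trivial
      fun y hy => ih hy fun t => h _)

lemma IsMonochromatic.mono {c : G → κ} {A B : Set G} (hB : IsMonochromatic c B)
    (h : A ⊆ B) : IsMonochromatic c A :=
  hB.imp fun _ ha g hg => ha g (h hg)

lemma isInvariant_contentMean [Group G] (hμ : IsInvariantProb μ) :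
    (contentMean μ hμ.univ_eq_one).IsInvariant :=
  ⟨fun g _ hf => contentMean_mul_left μ hμ g hf, fun g _ hf => contentMean_mul_right μ hμ g hf⟩

lemma many_of_tupleMean_pos [Nonempty G] (hμ : μ Set.univ = 1) {n : ℕ} {p : (Fin n → G) → Prop}
    (h : 0 < tupleMean (contentMean μ hμ) n fun t => ind (p t)) : Many μ n p := by
  induction n with
  | zero =>
    by_contra hn
    rw [tupleMean_zero, ind_of_not (p := p Fin.elim0) hn] at h
    exact h.false
  | succ n ih =>
    rw [tupleMean_succ] at h
    exact (measure_pos_of_contentMean_pos μ hμ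
      (fun y => Mean.le_of_forall_ge _ (.ind _) fun _ => ind_nonneg _)
      (fun y => Mean.le_of_forall_le _ (.ind _) fun _ => ind_le_one _) h).trans_le
      (addContent_mono isSetRing_univ.isSetSemiring trivial trivial fun y hy => ih hy)

end Content

theorem theorem1_general {G κ : Type*} [Group G] [Finite κ]
    (μ : MeasureTheory.AddContent ℝ≥0 (Set.univ : Set (Set G))) (hμ : IsInvariantProb μ)
    (c : G → κ) :
    0 < μ {y : G | 0 < μ {x : G | IsMonochromatic c {x, y, x * y, y * x}}} ∧
    ∀ k : ℕ, Many μ (k + 1) fun t : Fin (k + 1) → G =>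
      IsMonochromatic c (productPattern fun i : Fin (k + 1) => t (Fin.rev i)) := by
  have hmany (k : ℕ) : Many μ (k + 1) fun t : Fin (k + 1) → G =>
      IsMonochromatic c (productPattern fun i : Fin (k + 1) => t (Fin.rev i)) := by
    obtain ⟨a, ha⟩ := exists_richMean_pos (isInvariant_contentMean hμ) c (k + 1)
    exact (many_of_tupleMean_pos hμ.univ_eq_one ha).mono fun t ht =>
      ⟨a, ht.eq_of_mem_productPattern⟩
  refine ⟨?_, hmany⟩
  have hpair : Many μ 2 fun t => IsMonochromatic c {t 1, t 0, t 1 * t 0, t 0 * t 1} :=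
    (hmany 1).mono fun t ht => ht.mono <| (insert_subset_productPattern _ _).trans_eq <|
      congrArg productPattern <| funext fun i => by fin_cases i <;> rfl
  exact hpair

/- In the second part the tuple `t` lists `(x k, …, x 1, x 0)`: the outermost measure is taken
over `x k` and the innermost one over `x 0`. -/
theorem theorem1 {G : Type*} [Group G]
    (μ : MeasureTheory.AddContent ℝ≥0 (Set.univ : Set (Set G))) (hμ : IsInvariantProb μ)
    (r : ℕ) (c : G → Fin r) :
    0 < μ {y : G | 0 < μ {x : G | IsMonochromatic c {x, y, x * y, y * x}}} ∧
    ∀ k : ℕ, Many μ (k + 1) fun t : Fin (k + 1) → G =>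
      IsMonochromatic c (productPattern fun i : Fin (k + 1) => t (Fin.rev i)) :=
  theorem1_general μ hμ c
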